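/- Let $k$ be an algebraically closed field of characteristic zero, let $V_1,\dots,V_n$ be vector spaces over $k$ of finite dimensions $\dim V_i=d_i+1\ge 1$, and let $s_1,\dots,s_n\ge 1$ be integers. Put $A=V_1^{\otimes s_1}\otimes\cdots\otimes V_n^{\otimes s_n}$ and let \[X=\{[v_1^{\otimes s_1}\otimes\cdots\otimes v_n^{\otimes s_n}] : 0\ne v_i\in V_i\}\subset\mathbb{P}(A)\] be the Segre--Veronese variety, that is, the image of $\mathbb{P}(V_1)\times\cdots\times\mathbb{P}(V_n)$ under the embedding given by $\mathcal{O}(s_1)\boxtimes\cdots\boxtimes\mathcal{O}(s_n)$. Let $\operatorname{Sec}X\subset\mathbb{P}(A)$ be its secant variety, the Zariski closure of the union of the linear spans $\langle x,y\rangle$, $x,y\in X$, and let $\operatorname{Tan}X\subset\mathbb{P}(A)$ be its tangential variety, the Zariski closure of the union of the embedded projective tangent spaces of $X$ at its points. Let $P\subset\mathbb{Q}^{d_1+\cdots+d_n}$ be the polytope, in coordinates $x_{ij}$ with $1\le i\le n$, $1\le j\le d_i$, defined by \[x_{ij}\ge 0\ \text{ for all } i,j,\qquad \sum_{j=1}^{d_i}x_{ij}\le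 s_i\ \text{ for all } i,\qquad \sum_{i,j}x_{ij}\ge 2 .\] Then the following conditions are equivalent: \begin{enumerate} \item[(i)] $P$ is not contained in the hyperplane $\sum_{i,j}x_{ij}=2$; \item[(ii)] $\dim\operatorname{Sec}X=2\dim X+1$; \item[(iii)] $\operatorname{Sec}X\ne\operatorname{Tan}X$; \item[(iv)] $\dim\operatorname{Tan}X=\dim\operatorname{Sec}X-1$. \end{enumerate} In particular, Zak's theorem holds for $X$: either $\dim\operatorname{Tan}X=2\dim X$ and $\dim\operatorname{Sec}X=2\dim X+1$, or $\operatorname{Tan}X=\operatorname{Sec}X$. -/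

import Mathlib

open scoped LinearAlgebra.Projectivization TensorProduct

namespace SegreVeronese

/-! ### Projective varieties in `ℙ k W`, classical language -/

section Projective

variable {k : Type*} [Field k] {W : Type*} [AddCommGroup W] [Module k W]

/-- Polynomial functions on the vector space `W`, written without coordinates: polynomials
whose variables are the linear forms on `W`. The value at `w` substitutes `φ w` for the
variable `φ`. -/
noncomputable def polyEval (f : MvPolynomial (Module.Dual k W) k) (w : W) : k :=
  MvPolynomial.eval (fun φ : Module.Dual k W => φ w) f

/-- `f` vanishes at the point `p`. It is used for homogeneous `f` only, where the choice of the
representative of `p` does not matter. -/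
def VanishesAt (f : MvPolynomial (Module.Dual k W) k) (p : ℙ k W) : Prop :=
  polyEval f p.rep = 0

/-- The common zeros in `ℙ k W` of a set of polynomials. -/
def zeroSet (S : Set (MvPolynomial (Module.Dual k W) k)) : Set (ℙ k W) :=
  {p | ∀ f ∈ S, VanishesAt f p}

/-- A projective algebraic set: the common zeros of a set of homogeneous polynomials. -/
def IsProjectiveAlgebraic (Z : Set (ℙ k W)) : Prop :=
  ∃ S : Set (MvPolynomial (Module.Dual k W) k),
    (∀ f ∈ S, ∃ m : ℕ, f.IsHomogeneous m) ∧ Z = zeroSet S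

/-- The Zariski topology on `ℙ k W`: the closed sets are the projective algebraic sets. -/
instance zariskiTopology : TopologicalSpace (ℙ k W) :=
  TopologicalSpace.ofClosed {Z | IsProjectiveAlgebraic Z}
    (by
      refine ⟨{1}, ?_, ?_⟩
      · rintro f rfl
        exact ⟨0, MvPolynomial.isHomogeneous_one _ _⟩
      · ext p
        simp [zeroSet, VanishesAt, polyEval])
    (by
      intro 𝒜 h𝒜
      refine ⟨{f | (∃ m : ℕ, f.IsHomogeneous m) ∧ ∃ Z ∈ 𝒜, ∀ p ∈ Z, VanishesAt f p},
        fun f hf => hf.1, ?_⟩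
      ext p
      constructor
      · rintro hp f ⟨-, Z, hZ, hf⟩
        exact hf p (hp Z hZ)
      · intro hp Z hZ
        obtain ⟨S, hS, rfl⟩ := h𝒜 hZ
        intro f hf
        exact hp f ⟨hS f hf, _, hZ, fun q hq => hq f hf⟩)
    (by
      rintro Z ⟨S, hS, rfl⟩ Y ⟨T, hT, rfl⟩
      refine ⟨{h | ∃ f ∈ S, ∃ g ∈ T, h = f * g}, ?_, ?_⟩
      · rintro h ⟨f, hf, g, hg, rfl⟩
        obtain ⟨a, ha⟩ := hS f hf
        obtain ⟨b, hb⟩ := hT g hg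
        exact ⟨a + b, ha.mul hb⟩
      · ext p
        constructor
        · rintro (hp | hp) h ⟨f, hf, g, hg, rfl⟩
          · have h0 : polyEval f p.rep = 0 := hp f hf
            simp only [polyEval] at h0
            simp [VanishesAt, polyEval, h0]
          · have h0 : polyEval g p.rep = 0 := hp g hg
            simp only [polyEval] at h0
            simp [VanishesAt, polyEval, h0]
        · intro hp
          by_contra hcon
          simp only [Set.mem_union, not_or, zeroSet, Set.mem_ofPred_eq, not_forall] at hcon
          obtain ⟨⟨f, hf, hf0⟩, ⟨g, hg, hg0⟩⟩ := hcon
          have h0 := hp (f * g) ⟨f, hf, g, hg, rfl⟩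
          simp only [VanishesAt, polyEval, map_mul, mul_eq_zero] at h0 hf0 hg0
          exact h0.elim hf0 hg0)

/-- The secant variety: the Zariski closure of the union of the lines `⟨x, y⟩` spanned by two
points of `X`. (A pair with `x = y` contributes just the point `x`; this matters only when `X`
is a single point, whose secant variety is then that point.) -/
def secantVariety (X : Set (ℙ k W)) : Set (ℙ k W) :=
  closure {p | ∃ x ∈ X, ∃ y ∈ X, p.submodule ≤ x.submodule ⊔ y.submodule}

/-- The restriction `f (w + t u)` of `f` to a parametrized line, as a polynomial in `t`. -/
noncomputable def restrictLine (f : MvPolynomial (Module.Dual k W) k) (w u : W) : Polynomial k :=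
  MvPolynomial.aeval
    (fun φ : Module.Dual k W => Polynomial.C (φ w) + Polynomial.C (φ u) * Polynomial.X) f

/-- The embedded projective tangent space of `X` at `x`: the union of `{x}` and all the lines
through `x` to which every homogeneous equation of `X` restricts with a zero of order at least
two at `x`. -/
def tangentSpaceAt (X : Set (ℙ k W)) (x : ℙ k W) : Set (ℙ k W) :=
  {p | ∀ (f : MvPolynomial (Module.Dual k W) k) (m : ℕ), f.IsHomogeneous m →
    (∀ y ∈ X, VanishesAt f y) → Polynomial.X ^ 2 ∣ restrictLine f x.rep p.rep}

/-- The tangential variety: the Zariski closure of the union of the projective tangent spaces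
(equivalently, of the tangent lines) of `X`. -/
def tangentialVariety (X : Set (ℙ k W)) : Set (ℙ k W) :=
  closure {p | ∃ x ∈ X, p ∈ tangentSpaceAt X x}

/-- The dimension of a subset of `ℙ k W`: the Krull dimension of its Zariski topology. -/
noncomputable def dim (X : Set (ℙ k W)) : WithBot ℕ∞ :=
  topologicalKrullDim X

end Projective

/-! ### Segre–Veronese varieties -/

section SegreVeronese

variable (k : Type*) [Field k] {n : ℕ} (V : Fin n → Type*)
  [∀ i, AddCommGroup (V i)] [∀ i, Module k (V i)] (s : Fin n → ℕ)

/-- The ambient space `V₁^{⊗ s₁} ⊗ ⋯ ⊗ Vₙ^{⊗ sₙ}`. -/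
abbrev Ambient : Type _ :=
  ⨂[k] q : (Σ i : Fin n, Fin (s i)), V q.1

/-- The parametrization `(v₁, …, vₙ) ↦ v₁^{⊗ s₁} ⊗ ⋯ ⊗ vₙ^{⊗ sₙ}` of the cone. -/
noncomputable def conePoint (v : ∀ i, V i) : Ambient k V s :=
  PiTensorProduct.tprod k (fun q : (Σ i : Fin n, Fin (s i)) => v q.1)

/-- The Segre–Veronese variety `v_{s₁}(ℙ V₁) × ⋯ × v_{sₙ}(ℙ Vₙ)`: the set of the points
`[v₁^{⊗ s₁} ⊗ ⋯ ⊗ vₙ^{⊗ sₙ}]` with all `vᵢ ≠ 0`. -/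
def variety : Set (ℙ k (Ambient k V s)) :=
  {p | ∃ v : ∀ i, V i, (∀ i, v i ≠ 0) ∧
    p.submodule = Submodule.span k {conePoint k V s v}}

end SegreVeronese

/-- The polytope `P` in the rational vector space with coordinates indexed by the pairs `(i, j)`,
`1 ≤ i ≤ n`, `1 ≤ j ≤ dᵢ`. -/
def polytope {n : ℕ} (d s : Fin n → ℕ) : Set ((Σ i : Fin n, Fin (d i)) → ℚ) :=
  {x | (∀ q, 0 ≤ x q) ∧ (∀ i, ∑ j : Fin (d i), x ⟨i, j⟩ ≤ (s i : ℚ)) ∧ 2 ≤ ∑ q, x q}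

/-- The hyperplane on which the coordinates sum to `2`. -/
def hyperplaneTwo {n : ℕ} (d : Fin n → ℕ) : Set ((Σ i : Fin n, Fin (d i)) → ℚ) :=
  {x | ∑ q, x q = 2}

end SegreVeronese

/-! Everything is governed by one integer: the number of nontrivial slots, that is, of pairs (i, r)
with 1 ≤ r ≤ s_i and d_i > 0. It equals the sum of the s_i with d_i > 0, which is the maximum of the
coordinate sum under the constraints of the polytope other than the last. Hence (i) says that there
are at least three such slots.

With at most two nontrivial slots, Sec X = Tan X by explicit formulas (`add_mem_tangentCone`). Up to
rescaling, the problem is about vectors, matrices or symmetric matrices, where a sum of two rank-one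
elements is visibly tangent; the symmetric case factors a binary quadratic form over the
algebraically closed field. Then dim Sec X ≤ 2 dim X is finite, and (ii)–(iv) fail.

With at least three, contract a tensor to a 2 × 2 × 2 array in three nontrivial slots. Cayley's
hyperdeterminant vanishes on tangents but not on a sum of two general points, so Tan X ≠ Sec X. A
cubic built from the third cumulant recovers the tangent direction and gives dim Tan X = 2 dim X.
Since Sec X is irreducible and contains Tan X as a proper closed subset, its dimension is at least 2
dim X + 1, and counting parameters gives equality.

Dimensions are Krull dimensions of Zariski topologies, so both bounds are proved with chains. Above
(`topologicalKrullDim_le_of_subset_closure`): a chain of irreducible closed sets yields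
algebraically independent polynomials on a cone, and their number is bounded by the number of
parameters. Below (`card_le_topologicalKrullDim`): the parameters are freed one at a time, and an
equation detecting each parameter makes the chain strict. Tangent spaces are defined by all
equations of X; `rep_mem_tangentCone` identifies them with the derivatives of the parametrization.
-/

namespace SegreVeronese

/-! ### Chains of irreducible sets and dimension -/

section Topology

open TopologicalSpace

variable {α : Type*} [TopologicalSpace α]

theorem isIrreducible_preimage_val {S T : Set α} (hS : IsIrreducible S) (hST : S ⊆ T) :
    IsIrreducible ((↑) ⁻¹' S : Set T) := by
  obtain ⟨⟨x, hx⟩, hS⟩ := hS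
  refine ⟨⟨⟨x, hST hx⟩, hx⟩, ?_⟩
  rintro u v hu hv ⟨y, hyS, hyu⟩ ⟨z, hzS, hzv⟩
  obtain ⟨u, hu', rfl⟩ := isOpen_induced_iff.1 hu
  obtain ⟨v, hv', rfl⟩ := isOpen_induced_iff.1 hv
  obtain ⟨w, hwS, hwu, hwv⟩ := hS u v hu' hv' ⟨y, hyS, hyu⟩ ⟨z, hzS, hzv⟩
  exact ⟨⟨w, hST hwS⟩, hwS, hwu, hwv⟩

/-- A chain of irreducible subsets with strictly increasing closures bounds the dimension of any
set containing it from below. -/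
theorem le_topologicalKrullDim_of_chain {T : Set α} {N : ℕ} (S : Fin (N + 1) → Set α)
    (hirr : ∀ j, IsIrreducible (S j)) (hT : ∀ j, S j ⊆ T) (hmono : Monotone S)
    (hlt : ∀ j : Fin N, ¬ S j.succ ⊆ closure (S j.castSucc)) :
    (N : WithBot ℕ∞) ≤ topologicalKrullDim T := by
  let Z : Fin (N + 1) → IrreducibleCloseds T := fun j =>
    ⟨closure ((↑) ⁻¹' S j), (isIrreducible_preimage_val (hirr j) (hT j)).closure,
      isClosed_closure⟩
  have hZ : StrictMono Z := by
    refine Fin.strictMono_iff_lt_succ.2 fun j => lt_of_le_not_ge ?_ fun h => hlt j fun x hx => ?_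
    · exact closure_mono (Set.preimage_mono (hmono (Fin.castSucc_lt_succ).le))
    · have h1 : (⟨x, hT _ hx⟩ : T) ∈ closure ((↑) ⁻¹' S j.castSucc : Set T) :=
        h (subset_closure (show (⟨x, hT _ hx⟩ : T) ∈ ((↑) ⁻¹' S j.succ : Set T) from hx))
      rw [closure_subtype] at h1
      exact closure_mono (Set.image_preimage_subset _ _) h1
  exact Order.LTSeries.length_le_krullDim (LTSeries.mk N Z hZ)

theorem topologicalKrullDim_mono {S T : Set α} (h : S ⊆ T) :
    topologicalKrullDim S ≤ topologicalKrullDim T :=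
  (Topology.IsEmbedding.inclusion h).isInducing.topologicalKrullDim_le

/-- A proper closed subset of an irreducible closed set has smaller dimension. -/
theorem topologicalKrullDim_add_one_le {S T : Set α} (hS : IsClosed S) (hSne : S.Nonempty)
    (hT : IsIrreducible T) (hST : S ⊆ T) (hne : S ≠ T) :
    topologicalKrullDim S + 1 ≤ topologicalKrullDim T := by
  have : IrreducibleSpace T := isIrreducible_iff_irreducibleSpace.1 hT
  obtain ⟨x, hx⟩ := hSne
  have : Nonempty (IrreducibleCloseds S) :=
    ⟨⟨closure {⟨x, hx⟩}, isIrreducible_singleton.closure, isClosed_closure⟩⟩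
  have hind := (Topology.IsEmbedding.inclusion hST).isInducing
  -- The added top element, which raises the dimension by one, goes to `T` itself. The map stays
  -- strictly monotone because `S` is closed and proper in `T`.
  let g : WithTop (IrreducibleCloseds S) → IrreducibleCloseds T := fun z =>
    z.recTopCoe ⟨Set.univ, IrreducibleSpace.isIrreducible_univ _, isClosed_univ⟩
      (fun z => IrreducibleCloseds.map _ hind.continuous z)
  unfold topologicalKrullDim
  rw [← Order.krullDim_WithTop]
  refine Order.krullDim_le_of_strictMono g fun a b hab => ?_
  induction a with
  | top => exact absurd hab not_top_lt
  | coe a =>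
    induction b with
    | top =>
      refine lt_of_le_not_ge (fun _ _ => Set.mem_univ _) fun h => hne (hST.antisymm fun y hy => ?_)
      have h1 : (⟨y, hy⟩ : T) ∈ closure (Set.inclusion hST '' (a : Set S)) := h (Set.mem_univ _)
      rw [closure_subtype] at h1
      have h2 : ((↑) '' (Set.inclusion hST '' (a : Set S)) : Set α) ⊆ S := by
        rintro _ ⟨_, ⟨z, -, rfl⟩, rfl⟩
        exact z.2
      exact hS.closure_subset_iff.2 h2 h1
    | coe b => exact IrreducibleCloseds.map_strictMono_of_isInducing hind (WithTop.coe_lt_coe.1 hab)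

end Topology

/-! ### Algebraic independence along a chain of primes -/

section Algebra

variable {k R : Type*} [Field k] [CommRing R] [Algebra k R]

/-- `f` is a finite family in `R` that is algebraically independent modulo the ideal `I`. -/
def IndepModulo {ι : Type*} (f : ι → R) (I : Ideal R) : Prop :=
  ∀ Q : MvPolynomial ι k, MvPolynomial.aeval f Q ∈ I → Q = 0

theorem indepModulo_of_isEmpty {ι : Type*} [IsEmpty ι] (f : ι → R) {I : Ideal R} (hI : I ≠ ⊤) :
    IndepModulo (k := k) f I := by
  intro Q hQ
  obtain ⟨a, rfl⟩ := MvPolynomial.C_surjective ι Q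
  by_contra ha
  have ha : a ≠ 0 := fun h => ha (by simp [h])
  rw [MvPolynomial.aeval_C] at hQ
  exact hI (Ideal.eq_top_of_isUnit_mem _ hQ ((IsUnit.mk0 a ha).map (algebraMap k R)))

/-- Read a relation as a polynomial in `g` over polynomials in `f`. Modulo `J` only its constant
coefficient survives, so that coefficient is zero. Then `g` factors out, and primality of `I` with
`g ∉ I` leaves a relation of smaller degree. Each link in a chain of primes thus gains one
independent element. -/
theorem IndepModulo.option {ι : Type*} {f : ι → R} {I J : Ideal R} (hf : IndepModulo (k := k) f J)
    (hI : I.IsPrime) (hIJ : I ≤ J) {g : R} (hgJ : g ∈ J) (hgI : g ∉ I) :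
    IndepModulo (k := k) (fun o : Option ι => o.elim g f) I := by
  have key : ∀ (N : ℕ) (q : Polynomial (MvPolynomial ι k)), q.natDegree < N →
      q.eval₂ ((MvPolynomial.aeval f : MvPolynomial ι k →ₐ[k] R) : MvPolynomial ι k →+* R) g ∈ I →
        q = 0 := by
    intro N
    induction N with
    | zero => intro q hq; omega
    | succ N ih =>
      intro q hq hqI
      have h0 : q.coeff 0 = 0 := by
        apply hf
        rw [← Polynomial.divX_mul_X_add q, Polynomial.eval₂_add, Polynomial.eval₂_mul,
          Polynomial.eval₂_X, Polynomial.eval₂_C] at hqI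
        exact (Ideal.add_mem_iff_right _ (Ideal.mul_mem_left _ _ hgJ)).1 (hIJ hqI)
      have hq' : q = q.divX * Polynomial.X := by
        conv_lhs => rw [← Polynomial.divX_mul_X_add q, h0, map_zero, add_zero]
      rw [hq', Polynomial.eval₂_mul, Polynomial.eval₂_X] at hqI
      have h1 := (hI.mem_or_mem hqI).resolve_right hgI
      by_cases hd : q.natDegree = 0
      · rw [Polynomial.eq_C_of_natDegree_eq_zero hd, h0, map_zero]
      · have := ih q.divX (by rw [Polynomial.natDegree_divX_eq_natDegree_tsub_one]; omega) h1
        rw [hq', this, zero_mul]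
  intro Q hQ
  have h1 : MvPolynomial.aeval (fun o : Option ι => o.elim g f) Q =
      (MvPolynomial.optionEquivLeft k ι Q).eval₂
        ((MvPolynomial.aeval f : MvPolynomial ι k →ₐ[k] R) : MvPolynomial ι k →+* R) g := by
    clear hQ
    induction Q using MvPolynomial.induction_on with
    | C a => simp
    | add p q hp hq => simp [hp, hq, Polynomial.eval₂_add]
    | mul_X p o hp => cases o <;> simp [hp, Polynomial.eval₂_mul]
  rw [h1] at hQ
  exact (MvPolynomial.optionEquivLeft k ι).map_eq_zero_iff.1 (key _ _ (Nat.lt_succ_self _) hQ)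

/-- The kernel of `θ` lies in `I`, so the family stays independent in a polynomial ring whose
transcendence degree is the number of its variables. -/
theorem IndepModulo.card_le {ι σ : Type*} [Fintype ι] [Fintype σ] {f : ι → R} {I : Ideal R}
    (hf : IndepModulo (k := k) f I) (θ : R →ₐ[k] MvPolynomial σ k) (hθ : ∀ r, θ r = 0 → r ∈ I) :
    Fintype.card ι ≤ Fintype.card σ := by
  have h : AlgebraicIndependent k (fun i => θ (f i)) := by
    refine algebraicIndependent_iff.2 fun Q hQ => hf Q (hθ _ ?_)
    rw [← hQ, ← MvPolynomial.comp_aeval_apply]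
  have := h.lift_cardinalMk_le_trdeg
  rw [MvPolynomial.trdeg_of_isDomain] at this
  simpa using this

end Algebra

/-! ### Zariski closures and vanishing ideals -/

section Zariski

variable {k : Type*} [Field k] {W : Type*} [AddCommGroup W] [Module k W]

theorem polyEval_add (f g : MvPolynomial (Module.Dual k W) k) (w : W) :
    polyEval (f + g) w = polyEval f w + polyEval g w := map_add _ f g

theorem polyEval_mul (f g : MvPolynomial (Module.Dual k W) k) (w : W) :
    polyEval (f * g) w = polyEval f w * polyEval g w := map_mul _ f g

theorem polyEval_X (φ : Module.Dual k W) (w : W) : polyEval (MvPolynomial.X φ) w = φ w :=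
  MvPolynomial.eval_X _

theorem vanishesAt_iff {f : MvPolynomial (Module.Dual k W) k} {p : ℙ k W} :
    VanishesAt f p ↔ polyEval f p.rep = 0 := Iff.rfl

theorem isClosed_iff_isProjectiveAlgebraic {Z : Set (ℙ k W)} :
    IsClosed Z ↔ IsProjectiveAlgebraic Z := by
  rw [← isOpen_compl_iff]
  change Zᶜᶜ ∈ {Z | IsProjectiveAlgebraic Z} ↔ _
  rw [compl_compl]
  rfl

theorem isClosed_setOf_vanishesAt {f : MvPolynomial (Module.Dual k W) k} {m : ℕ}
    (hf : f.IsHomogeneous m) : IsClosed {p | VanishesAt f p} :=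
  isClosed_iff_isProjectiveAlgebraic.2 ⟨{f}, by rintro _ rfl; exact ⟨m, hf⟩, by
    ext p; simp [zeroSet]⟩

theorem mem_closure_iff_vanishesAt {S : Set (ℙ k W)} {p : ℙ k W} :
    p ∈ closure S ↔ ∀ (f : MvPolynomial (Module.Dual k W) k) (m : ℕ), f.IsHomogeneous m →
      (∀ q ∈ S, VanishesAt f q) → VanishesAt f p := by
  constructor
  · intro hp f m hf hS
    exact closure_minimal (t := {p | VanishesAt f p}) hS (isClosed_setOf_vanishesAt hf) hp
  · intro h
    obtain ⟨F, hF, hSF⟩ := isClosed_iff_isProjectiveAlgebraic.1 (isClosed_closure (s := S))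
    rw [hSF]
    intro f hf
    obtain ⟨m, hm⟩ := hF f hf
    refine h f m hm fun q hq => ?_
    have : q ∈ zeroSet F := hSF ▸ subset_closure hq
    exact this f hf

theorem polyEval_smul {f : MvPolynomial (Module.Dual k W) k} {m : ℕ} (hf : f.IsHomogeneous m)
    (a : k) (w : W) : polyEval f (a • w) = a ^ m * polyEval f w := by
  unfold polyEval
  rw [MvPolynomial.eval_eq, MvPolynomial.eval_eq, Finset.mul_sum]
  refine Finset.sum_congr rfl fun d hd => ?_
  have hd' : d.degree = m := by
    rw [← hf (MvPolynomial.mem_support_iff.1 hd), Finsupp.degree_eq_weight_one]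
    rfl
  have : ∏ i ∈ d.support, (i (a • w)) ^ d i = a ^ m * ∏ i ∈ d.support, (i w) ^ d i := by
    simp only [map_smul, smul_eq_mul, mul_pow, Finset.prod_mul_distrib]
    rw [Finset.prod_pow_eq_pow_sum, ← hd']
    rfl
  rw [this]
  ring

theorem vanishesAt_mk_iff {f : MvPolynomial (Module.Dual k W) k} {m : ℕ} (hf : f.IsHomogeneous m)
    {w : W} (hw : w ≠ 0) : VanishesAt f (Projectivization.mk k w hw) ↔ polyEval f w = 0 := by
  obtain ⟨a, ha⟩ := Projectivization.exists_smul_eq_mk_rep k w hw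
  rw [VanishesAt, ← ha, Units.smul_def, polyEval_smul hf]
  simp

theorem polyEval_zero_of_vanishesAt {f : MvPolynomial (Module.Dual k W) k} {m : ℕ}
    (hf : f.IsHomogeneous m) {p : ℙ k W} (hp : VanishesAt f p) : polyEval f (0 : W) = 0 := by
  rw [← zero_smul k p.rep, polyEval_smul hf, show polyEval f p.rep = 0 from hp, mul_zero]

/-- The points of `ℙ k W` represented by the nonzero vectors of a set `C`. -/
def projPoints (C : Set W) : Set (ℙ k W) :=
  {p | ∃ w ∈ C, ∃ hw : w ≠ 0, p = Projectivization.mk k w hw}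

theorem mk_mem_projPoints {C : Set W} {w : W} (h : w ∈ C) (hw : w ≠ 0) :
    Projectivization.mk k w hw ∈ projPoints (k := k) C := ⟨w, h, hw, rfl⟩

theorem forall_projPoints_vanishesAt_iff {C : Set W} (hC : (projPoints (k := k) C).Nonempty)
    {f : MvPolynomial (Module.Dual k W) k} {m : ℕ} (hf : f.IsHomogeneous m) :
    (∀ p ∈ projPoints (k := k) C, VanishesAt f p) ↔ ∀ w ∈ C, polyEval f w = 0 := by
  constructor
  · intro h w hw
    by_cases hw0 : w = 0
    · obtain ⟨p, hp⟩ := hC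
      rw [hw0]
      exact polyEval_zero_of_vanishesAt hf (h p hp)
    · exact (vanishesAt_mk_iff hf hw0).1 (h _ (mk_mem_projPoints hw hw0))
  · rintro h _ ⟨w, hwC, hw, rfl⟩
    exact (vanishesAt_mk_iff hf hw).2 (h w hwC)

/-- Comparison of closures in terms of the homogeneous equations of the cones. -/
theorem closure_projPoints_subset {C C' : Set W} (hC' : (projPoints (k := k) C').Nonempty)
    (h : ∀ (f : MvPolynomial (Module.Dual k W) k) (m : ℕ), f.IsHomogeneous m →
      (∀ w ∈ C', polyEval f w = 0) → ∀ w ∈ C, polyEval f w = 0) :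
    closure (projPoints (k := k) C) ⊆ closure (projPoints (k := k) C') := by
  refine closure_minimal ?_ isClosed_closure
  rintro _ ⟨w, hwC, hw, rfl⟩
  refine mem_closure_iff_vanishesAt.2 fun f m hf hf' => (vanishesAt_mk_iff hf hw).2 ?_
  exact h f m hf ((forall_projPoints_vanishesAt_iff hC' hf).1 hf') w hwC

/-- The ideal of the polynomials vanishing on the cone over `S`. -/
def coneIdeal (S : Set (ℙ k W)) : Ideal (MvPolynomial (Module.Dual k W) k) where
  carrier := {f | ∀ p ∈ S, ∀ a : k, polyEval f (a • p.rep) = 0}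
  add_mem' {f g} hf hg p hp a := by rw [polyEval_add, hf p hp a, hg p hp a, add_zero]
  zero_mem' p _ a := map_zero _
  smul_mem' g f hf p hp a := by rw [smul_eq_mul, polyEval_mul, hf p hp a, mul_zero]

theorem mem_coneIdeal_of_isHomogeneous {S : Set (ℙ k W)}
    {f : MvPolynomial (Module.Dual k W) k} {m : ℕ} (hf : f.IsHomogeneous m) :
    f ∈ coneIdeal S ↔ ∀ p ∈ S, VanishesAt f p := by
  refine forall₂_congr fun p _ => ⟨fun h => by simpa [vanishesAt_iff] using h 1, fun h a => ?_⟩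
  rw [polyEval_smul hf, show polyEval f p.rep = 0 from h, mul_zero]

/-- A polynomial vanishing on a line through the origin has all its homogeneous components
vanishing there. -/
theorem polyEval_homogeneousComponent_eq_zero [Infinite k]
    {f : MvPolynomial (Module.Dual k W) k} {w : W}
    (h : ∀ a : k, polyEval f (a • w) = 0) (d : ℕ) :
    polyEval (MvPolynomial.homogeneousComponent d f) w = 0 := by
  -- This is `f (a • w)` as a polynomial in `a`; its coefficients are the values of the homogeneous
  -- components at `w`.
  let P : Polynomial k := ∑ i ∈ Finset.range (f.totalDegree + 1),
    Polynomial.C (polyEval (MvPolynomial.homogeneousComponent i f) w) * Polynomial.X ^ i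
  have hP : P = 0 := by
    refine Polynomial.funext fun a => ?_
    rw [Polynomial.eval_zero, ← h a]
    have h1 : polyEval f (a • w) = ∑ i ∈ Finset.range (f.totalDegree + 1),
        polyEval (MvPolynomial.homogeneousComponent i f) (a • w) := by
      conv_lhs => rw [← MvPolynomial.sum_homogeneousComponent f]
      exact map_sum _ _ _
    rw [h1, Polynomial.eval_finsetSum]
    refine Finset.sum_congr rfl fun i _ => ?_
    rw [polyEval_smul (MvPolynomial.homogeneousComponent_isHomogeneous i f) a w, Polynomial.eval_mul,
      Polynomial.eval_C, Polynomial.eval_pow, Polynomial.eval_X, mul_comm]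
  by_cases hd : d ∈ Finset.range (f.totalDegree + 1)
  · have h1 := congrArg (fun P => Polynomial.coeff P d) hP
    simpa [P, Polynomial.finsetSum_coeff, Polynomial.coeff_C_mul, Polynomial.coeff_X_pow,
      Finset.mem_range.1 hd] using h1
  · rw [MvPolynomial.homogeneousComponent_eq_zero _ _ (by simpa using hd)]
    simp [polyEval]

/-- The ideal is homogeneous, so primality may be tested on homogeneous factors, where it is the
irreducibility of `S`. -/
theorem coneIdeal_isPrime [Infinite k] {S : Set (ℙ k W)} (hS : IsIrreducible S) :
    (coneIdeal S).IsPrime := by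
  let := MvPolynomial.gradedAlgebra (σ := Module.Dual k W) (R := k)
  have hhom : (coneIdeal S).IsHomogeneous
      (MvPolynomial.homogeneousSubmodule (Module.Dual k W) k) := by
    intro d f hf p hp a
    have h1 := polyEval_homogeneousComponent_eq_zero (f := f) (w := a • p.rep)
      (fun b => by rw [smul_smul]; exact hf p hp _) d
    rwa [← MvPolynomial.decomposition.decompose'_apply] at h1
  refine hhom.isPrime_of_homogeneous_mem_or_mem ?_ ?_
  · intro htop
    obtain ⟨p, hp⟩ := hS.1
    have : (1 : MvPolynomial (Module.Dual k W) k) ∈ coneIdeal S := htop ▸ Submodule.mem_top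
    simpa [polyEval] using this p hp 1
  · rintro f g ⟨a, hf⟩ ⟨b, hg⟩ hfg
    have hf : f.IsHomogeneous a := hf
    have hg : g.IsHomogeneous b := hg
    rw [mem_coneIdeal_of_isHomogeneous hf, mem_coneIdeal_of_isHomogeneous hg]
    rw [mem_coneIdeal_of_isHomogeneous (hf.mul hg)] at hfg
    refine isPreirreducible_iff_isClosed_union_isClosed.1 hS.2 _ _ (isClosed_setOf_vanishesAt hf)
      (isClosed_setOf_vanishesAt hg) fun p hp => ?_
    exact mul_eq_zero.1 ((polyEval_mul f g p.rep).symm.trans (hfg p hp))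

theorem isIrreducible_of_vanishesAt_mul {S : Set (ℙ k W)} (hS : S.Nonempty)
    (h : ∀ (f g : MvPolynomial (Module.Dual k W) k) (a b : ℕ), f.IsHomogeneous a →
      g.IsHomogeneous b → (∀ p ∈ S, VanishesAt (f * g) p) →
      (∀ p ∈ S, VanishesAt f p) ∨ ∀ p ∈ S, VanishesAt g p) : IsIrreducible S := by
  refine ⟨hS, isPreirreducible_iff_isClosed_union_isClosed.2 fun Y Z hY hZ hYZ => ?_⟩
  obtain ⟨F, hF, rfl⟩ := isClosed_iff_isProjectiveAlgebraic.1 hY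
  obtain ⟨G, hG, rfl⟩ := isClosed_iff_isProjectiveAlgebraic.1 hZ
  by_contra! hcon
  obtain ⟨⟨p, hp, hpF⟩, ⟨q, hq, hqG⟩⟩ := hcon.imp Set.not_subset.1 Set.not_subset.1
  simp only [zeroSet, Set.mem_ofPred_eq, not_forall] at hpF hqG
  obtain ⟨f, hf, hfp⟩ := hpF
  obtain ⟨g, hg, hgq⟩ := hqG
  obtain ⟨a, ha⟩ := hF f hf
  obtain ⟨b, hb⟩ := hG g hg
  have hfg : ∀ r ∈ S, VanishesAt (f * g) r := fun r hr => by
    rw [vanishesAt_iff, polyEval_mul]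
    rcases hYZ hr with hr | hr
    · rw [show polyEval f r.rep = 0 from hr f hf, zero_mul]
    · rw [show polyEval g r.rep = 0 from hr g hg, mul_zero]
  rcases h f g a b ha hb hfg with h | h
  · exact hfp (h p hp)
  · exact hgq (h q hq)

/-- Along a chain of `ℓ + 1` irreducible closed sets one finds `ℓ + 1` polynomials that are
algebraically independent on the cone over the largest member. -/
theorem exists_indepModulo_coneIdeal [Infinite k] (ℓ : ℕ) (Z : ℕ → Set (ℙ k W))
    (hirr : ∀ i ≤ ℓ, IsIrreducible (Z i)) (hcl : ∀ i ≤ ℓ, IsClosed (Z i))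
    (hlt : ∀ i < ℓ, Z i ⊂ Z (i + 1)) :
    ∃ (ι : Type) (_ : Fintype ι) (f : ι → MvPolynomial (Module.Dual k W) k),
      Fintype.card ι = ℓ + 1 ∧ IndepModulo (k := k) f (coneIdeal (Z ℓ)) := by
  induction ℓ with
  | zero =>
    obtain ⟨p, hp⟩ := (hirr 0 le_rfl).1
    obtain ⟨φ, hφ⟩ := Module.Projective.exists_dual_ne_zero k p.rep_nonzero
    -- The ideal of the vertex of the cone provides one more link below `Z 0`. It accounts for the
    -- shift from `ℓ` to `ℓ + 1`, that is, from projective to affine dimension.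
    let M : Ideal (MvPolynomial (Module.Dual k W) k) :=
      RingHom.ker (MvPolynomial.eval fun φ : Module.Dual k W => φ 0)
    refine ⟨Option Empty, inferInstance, _, by simp,
      (indepModulo_of_isEmpty (k := k) Empty.elim (I := M) (RingHom.ker_ne_top _)).option
        (coneIdeal_isPrime (hirr 0 le_rfl)) ?_ (g := MvPolynomial.X φ) ?_ ?_⟩
    · intro f hf
      have := hf p hp 0
      rwa [zero_smul] at this
    · simp [M, RingHom.mem_ker]
    · intro h
      have := h p hp 1
      simp [polyEval, hφ] at this
  | succ ℓ ih =>
    obtain ⟨ι, _, f, hcard, hf⟩ := ih (fun i hi => hirr i (by omega)) (fun i hi => hcl i (by omega))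
      fun i hi => hlt i (by omega)
    obtain ⟨hle, hnot⟩ := hlt ℓ (Nat.lt_succ_self ℓ)
    obtain ⟨p, hp, hpZ⟩ := Set.not_subset.1 hnot
    rw [← (hcl ℓ (by omega)).closure_eq, mem_closure_iff_vanishesAt] at hpZ
    push Not at hpZ
    obtain ⟨g, m, hg, hgZ, hgp⟩ := hpZ
    refine ⟨Option ι, inferInstance, _, by simp [hcard],
      hf.option (coneIdeal_isPrime (hirr _ le_rfl)) ?_ (g := g) ?_ ?_⟩
    · exact fun q hq p hp => hq p (hle hp)
    · exact (mem_coneIdeal_of_isHomogeneous hg).2 hgZ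
    · exact fun h => hgp ((mem_coneIdeal_of_isHomogeneous hg).1 h p hp)

end Zariski

/-! ### Polynomial maps and the dimension of their images -/

section PolyMap

variable {k : Type*} [Field k] {W : Type*} [AddCommGroup W] [Module k W] {σ τ : Type*}

/-- A map from an affine space to a vector space all of whose coordinates are polynomials. -/
def IsPolyMap (ψ : (σ → k) → W) : Prop :=
  ∀ φ : Module.Dual k W, ∃ P : MvPolynomial σ k, ∀ t, MvPolynomial.eval t P = φ (ψ t)

theorem IsPolyMap.exists_aeval {ψ : (σ → k) → W} (hψ : IsPolyMap ψ) :
    ∃ θ : MvPolynomial (Module.Dual k W) k →ₐ[k] MvPolynomial σ k,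
      ∀ f t, MvPolynomial.eval t (θ f) = polyEval f (ψ t) := by
  choose P hP using hψ
  refine ⟨MvPolynomial.aeval P, fun f t => ?_⟩
  induction f using MvPolynomial.induction_on with
  | C a => simp [polyEval]
  | add p q hp hq => rw [map_add, map_add, hp, hq, polyEval_add]
  | mul_X p φ hp => rw [map_mul, map_mul, hp, MvPolynomial.aeval_X, hP, polyEval_mul, polyEval_X]

theorem IsPolyMap.comp {ψ : (σ → k) → W} (hψ : IsPolyMap ψ) (g : σ → MvPolynomial τ k) :
    IsPolyMap fun t : τ → k => ψ fun i => MvPolynomial.eval t (g i) := by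
  intro φ
  obtain ⟨P, hP⟩ := hψ φ
  refine ⟨MvPolynomial.bind₁ g P, fun t => ?_⟩
  rw [← hP]
  change MvPolynomial.eval₂Hom _ t _ = _
  rw [MvPolynomial.eval₂Hom_bind₁]
  rfl

theorem IsPolyMap.add {ψ χ : (σ → k) → W} (hψ : IsPolyMap ψ) (hχ : IsPolyMap χ) :
    IsPolyMap fun t => ψ t + χ t := by
  intro φ
  obtain ⟨P, hP⟩ := hψ φ
  obtain ⟨Q, hQ⟩ := hχ φ
  exact ⟨P + Q, fun t => by rw [map_add, map_add, hP, hQ]⟩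

theorem IsPolyMap.coord_smul {ψ : (σ → k) → W} (hψ : IsPolyMap ψ) (i : σ) :
    IsPolyMap fun t => t i • ψ t := by
  intro φ
  obtain ⟨P, hP⟩ := hψ φ
  exact ⟨MvPolynomial.X i * P, fun t => by
    rw [map_mul, map_smul, hP, smul_eq_mul, MvPolynomial.eval_X]⟩

theorem IsPolyMap.const_smul {ψ : (σ → k) → W} (hψ : IsPolyMap ψ) (a : k) :
    IsPolyMap fun t => a • ψ t := by
  intro φ
  obtain ⟨P, hP⟩ := hψ φ
  exact ⟨MvPolynomial.C a * P, fun t => by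
    rw [map_mul, map_smul, hP, smul_eq_mul, MvPolynomial.eval_C]⟩

theorem isPolyMap_const (w : W) : IsPolyMap fun _ : σ → k => w :=
  fun φ => ⟨MvPolynomial.C (φ w), fun t => by simp⟩

theorem IsPolyMap.sum {ι : Type*} {s : Finset ι} {ψ : ι → (σ → k) → W}
    (hψ : ∀ i ∈ s, IsPolyMap (ψ i)) : IsPolyMap fun t => ∑ i ∈ s, ψ i t := by
  classical
  induction s using Finset.induction_on with
  | empty => simpa using isPolyMap_const (0 : W)
  | insert i s hi ih =>
    simp only [Finset.sum_insert hi]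
    exact (hψ i (Finset.mem_insert_self _ _)).add
      (ih fun j hj => hψ j (Finset.mem_insert_of_mem hj))

theorem IsPolyMap.tprod {ι : Type*} [Finite ι] {M : ι → Type*} [∀ i, AddCommGroup (M i)]
    [∀ i, Module k (M i)] [∀ i, Module.Finite k (M i)] {ψ : ∀ i, (σ → k) → M i}
    (hψ : ∀ i, IsPolyMap (ψ i)) :
    IsPolyMap fun t => PiTensorProduct.tprod k fun i => ψ i t := by
  classical
  have := Fintype.ofFinite ι
  intro φ
  let b := fun i => Module.finBasis k (M i)
  choose P hP using fun i j => hψ i ((b i).coord j)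
  refine ⟨∑ r : ∀ i, Fin (Module.finrank k (M i)),
    (∏ i, P i (r i)) * MvPolynomial.C (φ (PiTensorProduct.tprod k fun i => b i (r i))), fun t => ?_⟩
  have h : (fun i => ψ i t) = fun i => ∑ j, MvPolynomial.eval t (P i j) • b i j := by
    funext i
    conv_lhs => rw [← (b i).sum_repr (ψ i t)]
    exact Finset.sum_congr rfl fun j _ => by rw [hP]; rfl
  beta_reduce
  rw [h, MultilinearMap.map_sum, map_sum, map_sum]
  refine Finset.sum_congr rfl fun r _ => ?_
  rw [MultilinearMap.map_smul_univ, map_smul, map_mul, map_prod, MvPolynomial.eval_C, smul_eq_mul]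

/-- If a polynomial expression along a polynomial map vanishes wherever a nonzero polynomial does
not, then it vanishes everywhere. -/
theorem IsPolyMap.polyEval_eq_zero [Infinite k] {ψ : (σ → k) → W} (hψ : IsPolyMap ψ)
    {G : MvPolynomial σ k} (hG : G ≠ 0) {f : MvPolynomial (Module.Dual k W) k}
    (h : ∀ t, MvPolynomial.eval t G ≠ 0 → polyEval f (ψ t) = 0) (t : σ → k) :
    polyEval f (ψ t) = 0 := by
  obtain ⟨θ, hθ⟩ := hψ.exists_aeval
  have h1 : G * θ f = 0 := by
    refine MvPolynomial.funext fun t => ?_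
    rw [map_mul, hθ, map_zero, mul_eq_zero]
    exact or_iff_not_imp_left.2 (h t)
  rw [← hθ, (mul_eq_zero.1 h1).resolve_left hG, map_zero]

/-- Pulled back along `ψ`, a product of two equations that vanishes on the image is zero as a
polynomial because the field is infinite, and polynomial rings are domains. -/
theorem isIrreducible_projPoints_range [Infinite k] {ψ : (σ → k) → W} (hψ : IsPolyMap ψ)
    (hne : (projPoints (k := k) (Set.range ψ)).Nonempty) :
    IsIrreducible (projPoints (k := k) (Set.range ψ)) := by
  refine isIrreducible_of_vanishesAt_mul hne fun f g a b hf hg hfg => ?_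
  rw [forall_projPoints_vanishesAt_iff hne (hf.mul hg), Set.forall_mem_range] at hfg
  rw [forall_projPoints_vanishesAt_iff hne hf, forall_projPoints_vanishesAt_iff hne hg,
    Set.forall_mem_range, Set.forall_mem_range]
  obtain ⟨θ, hθ⟩ := hψ.exists_aeval
  have h1 : θ f * θ g = 0 := MvPolynomial.funext fun t => by
    rw [map_mul, hθ, hθ, ← polyEval_mul, hfg, map_zero]
  refine (mul_eq_zero.1 h1).imp (fun h t => ?_) fun h t => ?_ <;> rw [← hθ, h, map_zero]

/-- The projective variety of a cone parametrized by `N + 1` parameters has dimension at most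
`N`. -/
theorem topologicalKrullDim_le_of_subset_closure [Infinite k] [Fintype σ] {ψ : (σ → k) → W}
    (hψ : IsPolyMap ψ) (hcone : ∀ (a : k) t, a • ψ t ∈ Set.range ψ) {N : ℕ}
    (hN : Fintype.card σ = N + 1) {T : Set (ℙ k W)}
    (hT : T ⊆ closure (projPoints (k := k) (Set.range ψ))) : topologicalKrullDim T ≤ N := by
  refine iSup_le fun p => ?_
  -- The minimum extends the chain constantly beyond its length, so that it can be indexed by `ℕ`.
  let Z : ℕ → Set (ℙ k W) := fun i => TopologicalSpace.IrreducibleCloseds.map Subtype.val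
    continuous_subtype_val (p ⟨min i p.length, by omega⟩)
  have hlt : ∀ i < p.length, Z i ⊂ Z (i + 1) := by
    intro i hi
    refine TopologicalSpace.IrreducibleCloseds.map_strictMono_of_isInducing
      Topology.IsInducing.subtypeVal (p.strictMono ?_)
    rw [Fin.mk_lt_mk]
    omega
  obtain ⟨ι, _, f, hcard, hf⟩ := exists_indepModulo_coneIdeal p.length Z
    (fun i _ => TopologicalSpace.IrreducibleCloseds.isIrreducible _)
    (fun i _ => TopologicalSpace.IrreducibleCloseds.isClosed _) hlt
  obtain ⟨θ, hθ⟩ := hψ.exists_aeval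
  have hZ : Z p.length ⊆ closure (projPoints (k := k) (Set.range ψ)) := by
    refine closure_minimal ?_ isClosed_closure
    rintro _ ⟨x, -, rfl⟩
    exact hT x.2
  have := hf.card_le θ fun r hr q hq a => by
    -- Points of the closure satisfy only the homogeneous equations of the image, and `r` need not
    -- be homogeneous. Stability of the range under scaling makes every component of `r` vanish on
    -- it.
    have hcomp : ∀ d, polyEval (MvPolynomial.homogeneousComponent d r) q.rep = 0 := by
      intro d
      refine mem_closure_iff_vanishesAt.1 (hZ hq) _ d
        (MvPolynomial.homogeneousComponent_isHomogeneous d r) ?_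
      rintro _ ⟨_, ⟨t, rfl⟩, hw, rfl⟩
      refine (vanishesAt_mk_iff (MvPolynomial.homogeneousComponent_isHomogeneous d r) hw).2
        (polyEval_homogeneousComponent_eq_zero (fun a => ?_) d)
      obtain ⟨t', ht'⟩ := hcone a t
      rw [← ht', ← hθ, hr, map_zero]
    have h1 : polyEval r (a • q.rep) = ∑ i ∈ Finset.range (r.totalDegree + 1),
        polyEval (MvPolynomial.homogeneousComponent i r) (a • q.rep) := by
      conv_lhs => rw [← MvPolynomial.sum_homogeneousComponent r]
      exact map_sum _ _ _
    rw [h1]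
    refine Finset.sum_eq_zero fun i _ => ?_
    rw [polyEval_smul (MvPolynomial.homogeneousComponent_isHomogeneous i r), hcomp, mul_zero]
  have h2 : p.length ≤ N := by omega
  exact_mod_cast h2

/-- Lower bound for the dimension of the image of a polynomial map: it is enough to have, for each
parameter `tᵢ`, a homogeneous equation detecting whether `tᵢ` has a given value `cᵢ`. -/
theorem card_le_topologicalKrullDim [Infinite k] [Fintype σ] [DecidableEq σ] {ψ : (σ → k) → W}
    (hψ : IsPolyMap ψ) (hne : ∀ t, ψ t ≠ 0) (c : σ → k)
    (hf : ∀ i, ∃ (f : MvPolynomial (Module.Dual k W) k) (m : ℕ), f.IsHomogeneous m ∧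
      (∀ t, t i = c i → polyEval f (ψ t) = 0) ∧ ∃ a, polyEval f (ψ (Function.update c i a)) ≠ 0)
    {T : Set (ℙ k W)} (hT : projPoints (k := k) (Set.range ψ) ⊆ T) :
    (Fintype.card σ : WithBot ℕ∞) ≤ topologicalKrullDim T := by
  let e := Fintype.equivFin σ
  -- `r j` frees the first `j` parameters and freezes the others at `c`; the images form the chain.
  let r : Fin (Fintype.card σ + 1) → (σ → k) → σ → k := fun j t i =>
    if (e i).castSucc < j then t i else c i
  let S : Fin (Fintype.card σ + 1) → Set (ℙ k W) := fun j =>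
    projPoints (k := k) (Set.range fun t => ψ (r j t))
  have hpoly : ∀ j, IsPolyMap fun t => ψ (r j t) := by
    intro j
    convert hψ.comp (fun i => if (e i).castSucc < j then MvPolynomial.X i
      else MvPolynomial.C (c i) : σ → MvPolynomial σ k) using 3 with t
    funext i
    by_cases h : (e i).castSucc < j <;> simp [r, h]
  have hSne : ∀ j, (S j).Nonempty := fun j =>
    ⟨Projectivization.mk k _ (hne (r j c)), _, ⟨c, rfl⟩, hne _, rfl⟩
  refine le_topologicalKrullDim_of_chain S
    (fun j => isIrreducible_projPoints_range (hpoly j) (hSne j)) ?_ ?_ ?_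
  · rintro j _ ⟨_, ⟨t, rfl⟩, hw, rfl⟩
    exact hT (mk_mem_projPoints (Set.mem_range_self _) hw)
  · rintro j j' hj _ ⟨_, ⟨t, rfl⟩, hw, rfl⟩
    refine ⟨_, ⟨r j t, rfl⟩, hne _, ?_⟩
    have : r j' (r j t) = r j t := by
      funext i
      simp only [r]
      split_ifs with h1 h2 h2 <;> first | rfl | exact absurd (lt_of_lt_of_le h2 hj) h1
    simp only [this]
  · intro j hj
    -- The equation detecting the parameter that is about to be freed vanishes on the smaller image
    -- but not on the larger one.
    obtain ⟨f, m, hfm, hf0, a, hfa⟩ := hf (e.symm j)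
    have hmem : Projectivization.mk k (ψ (Function.update c (e.symm j) a)) (hne _) ∈ S j.succ := by
      refine ⟨_, ⟨Function.update c (e.symm j) a, rfl⟩, hne _, ?_⟩
      have : r j.succ (Function.update c (e.symm j) a) = Function.update c (e.symm j) a := by
        funext i
        simp only [r]
        split_ifs with h
        · rfl
        · rw [Function.update_of_ne]
          rintro rfl
          exact h (by simp)
      simp only [this]
    refine hfa ((vanishesAt_mk_iff hfm (hne _)).1
      (mem_closure_iff_vanishesAt.1 (hj hmem) f m hfm ?_))
    rintro _ ⟨_, ⟨t, rfl⟩, hw, rfl⟩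
    refine (vanishesAt_mk_iff hfm hw).2 (hf0 _ ?_)
    simp [r]

end PolyMap

/-! ### Cones over the Segre–Veronese variety, its secants and its tangents -/

section Cones

variable {k : Type*} [Field k] {n : ℕ} {V : Fin n → Type*}
  [∀ i, AddCommGroup (V i)] [∀ i, Module k (V i)] {s : Fin n → ℕ}

variable (k s) in
/-- The derivative of `conePoint` at `v` in the direction `u`. -/
noncomputable def tangentVector (v u : ∀ i, V i) : Ambient k V s :=
  (PiTensorProduct.tprod k).linearDeriv (fun q : (Σ i : Fin n, Fin (s i)) => v q.1)
    (fun q => u q.1)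

theorem tangentVector_eq_sum (v u : ∀ i, V i) : tangentVector k s v u =
    ∑ q : (Σ i : Fin n, Fin (s i)), PiTensorProduct.tprod k
      (Function.update (fun q : (Σ i : Fin n, Fin (s i)) => v q.1) q (u q.1)) :=
  MultilinearMap.linearDeriv_apply _ _ _

theorem tangentVector_add (v u u' : ∀ i, V i) :
    tangentVector k s v (u + u') = tangentVector k s v u + tangentVector k s v u' :=
  map_add _ _ _

theorem tangentVector_smul (v u : ∀ i, V i) (a : k) :
    tangentVector k s v (a • u) = a • tangentVector k s v u :=
  LinearMap.map_smul ((PiTensorProduct.tprod k).linearDeriv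
    fun q : (Σ i : Fin n, Fin (s i)) => v q.1) a fun q => u q.1

theorem tangentVector_zero (v : ∀ i, V i) : tangentVector k s v 0 = 0 :=
  map_zero _

theorem conePoint_smul (g : Fin n → k) (v : ∀ i, V i) :
    conePoint k V s (fun i => g i • v i) =
      (∏ q : (Σ i : Fin n, Fin (s i)), g q.1) • conePoint k V s v :=
  MultilinearMap.map_smul_univ _ (fun q : (Σ i : Fin n, Fin (s i)) => g q.1) _

theorem tangentVector_smul_smul (g : Fin n → k) (v u : ∀ i, V i) :
    tangentVector k s (fun i => g i • v i) (fun i => g i • u i) =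
      (∏ q : (Σ i : Fin n, Fin (s i)), g q.1) • tangentVector k s v u := by
  rw [tangentVector_eq_sum, tangentVector_eq_sum, Finset.smul_sum]
  refine Finset.sum_congr rfl fun q _ => ?_
  rw [← MultilinearMap.map_smul_univ]
  congr 1
  funext q'
  by_cases h : q' = q
  · subst h; simp
  · simp [h]

theorem tangentVector_smul_self (g : Fin n → k) (v : ∀ i, V i) :
    tangentVector k s v (fun i => g i • v i) =
      (∑ q : (Σ i : Fin n, Fin (s i)), g q.1) • conePoint k V s v := by
  rw [tangentVector_eq_sum, Finset.sum_smul]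
  refine Finset.sum_congr rfl fun q _ => ?_
  rw [MultilinearMap.map_update_smul, Function.update_eq_self]
  rfl

theorem conePoint_eq_zero (hs : ∀ i, 0 < s i) {v : ∀ i, V i} {i : Fin n} (hv : v i = 0) :
    conePoint k V s v = 0 :=
  MultilinearMap.map_coord_zero _ (⟨i, ⟨0, hs i⟩⟩ : Σ i : Fin n, Fin (s i)) hv

theorem conePoint_ne_zero {v : ∀ i, V i} (hv : ∀ i, v i ≠ 0) : conePoint k V s v ≠ 0 := by
  choose φ hφ using fun i => Module.Projective.exists_dual_eq_one k (hv i)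
  intro h
  have h1 := PiTensorProduct.dualDistrib_apply (R := k)
    (fun q : (Σ i : Fin n, Fin (s i)) => φ q.1) (fun q => v q.1)
  simp only [hφ, Finset.prod_const_one] at h1
  have h2 : PiTensorProduct.dualDistrib (PiTensorProduct.tprod k
      (fun q : (Σ i : Fin n, Fin (s i)) => φ q.1)) (conePoint k V s v) = 1 := h1
  rw [h, map_zero] at h2
  exact zero_ne_one h2

/-- In the multilinear expansion along `v + τ u`, sets of at least two slots contribute only to
order two and higher. Having polynomial coordinates lets limits and derivatives be treated
algebraically. -/
theorem exists_curve (v u : ∀ i, V i) :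
    ∃ Q : Module.Dual k (Ambient k V s) → Polynomial k, ∀ φ,
      (∀ τ, (Q φ).eval τ = φ (conePoint k V s (v + τ • u))) ∧
      (Q φ).coeff 0 = φ (conePoint k V s v) ∧ (Q φ).coeff 1 = φ (tangentVector k s v u) := by
  let x : ∀ q : (Σ i : Fin n, Fin (s i)), V q.1 := fun q => v q.1
  let y : ∀ q : (Σ i : Fin n, Fin (s i)), V q.1 := fun q => u q.1
  refine ⟨fun φ => Polynomial.C (φ (conePoint k V s v)) +
    Polynomial.X * Polynomial.C (φ (tangentVector k s v u)) +
    ∑ S : Finset (Σ i : Fin n, Fin (s i)) with 2 ≤ S.card,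
      Polynomial.X ^ S.card * Polynomial.C (φ (PiTensorProduct.tprod k (S.piecewise y x))),
    fun φ => ⟨fun τ => ?_, ?_, ?_⟩⟩
  · have h := (PiTensorProduct.tprod k).map_add_eq_map_add_linearDeriv_add x (τ • y)
    have h0 : conePoint k V s (v + τ • u) = PiTensorProduct.tprod k (x + τ • y) := rfl
    rw [h0, h, map_add, map_add, map_smul, map_smul, map_sum, Polynomial.eval_add,
      Polynomial.eval_add, Polynomial.eval_finsetSum, Polynomial.eval_C, Polynomial.eval_mul,
      Polynomial.eval_X, Polynomial.eval_C]
    refine congrArg₂ _ rfl (Finset.sum_congr rfl fun S _ => ?_)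
    have h1 : S.piecewise (τ • y) x =
        S.piecewise (fun q => τ • S.piecewise y x q) (S.piecewise y x) := by
      funext q
      by_cases hq : q ∈ S <;> simp [hq]
    rw [h1, MultilinearMap.map_piecewise_smul (PiTensorProduct.tprod k) (fun _ => τ)]
    simp only [Finset.prod_const, map_smul, smul_eq_mul, Polynomial.eval_mul, Polynomial.eval_pow,
      Polynomial.eval_X, Polynomial.eval_C]
  · rw [Polynomial.coeff_add, Polynomial.coeff_add, Polynomial.finsetSum_coeff,
      Finset.sum_eq_zero]
    · simp
    · intro S hS
      have : 2 ≤ S.card := by simpa using hS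
      rw [Polynomial.coeff_X_pow_mul', if_neg (by omega)]
  · rw [Polynomial.coeff_add, Polynomial.coeff_add, Polynomial.finsetSum_coeff,
      Finset.sum_eq_zero]
    · simp [Polynomial.coeff_C]
    · intro S hS
      have : 2 ≤ S.card := by simpa using hS
      rw [Polynomial.coeff_X_pow_mul', if_neg (by omega)]

theorem variety_eq_projPoints (hs : ∀ i, 0 < s i) :
    variety k V s = projPoints (Set.range (conePoint k V s)) := by
  ext p
  constructor
  · rintro ⟨v, hv, hp⟩
    refine ⟨_, ⟨v, rfl⟩, conePoint_ne_zero hv, Projectivization.submodule_injective ?_⟩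
    rw [hp, Projectivization.submodule_mk]
  · rintro ⟨_, ⟨v, rfl⟩, hw, rfl⟩
    exact ⟨v, fun i hi => hw (conePoint_eq_zero hs hi), Projectivization.submodule_mk _ _⟩

variable (k V s) in
/-- The linear combinations of two points of the cone. -/
def secantCone : Set (Ambient k V s) :=
  {w | ∃ (a b : k) (v v' : ∀ i, V i), w = a • conePoint k V s v + b • conePoint k V s v'}

variable (k V s) in
/-- The vectors tangent to the cone at nonzero points. -/
def tangentCone : Set (Ambient k V s) :=
  {w | ∃ (a : k) (v u : ∀ i, V i), (∀ i, v i ≠ 0) ∧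
    w = a • conePoint k V s v + tangentVector k s v u}

theorem secantVariety_eq (hs : ∀ i, 0 < s i) :
    secantVariety (variety k V s) = closure (projPoints (secantCone k V s)) := by
  unfold secantVariety
  congr 1
  rw [variety_eq_projPoints hs]
  ext p
  constructor
  · rintro ⟨_, ⟨_, ⟨v, rfl⟩, hv, rfl⟩, _, ⟨_, ⟨v', rfl⟩, hv', rfl⟩, hp⟩
    rw [Projectivization.submodule_mk, Projectivization.submodule_mk, ← Submodule.span_union,
      Projectivization.submodule_eq, Submodule.span_singleton_le_iff_mem,
      Set.singleton_union, Submodule.mem_span_pair] at hp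
    obtain ⟨a, b, hab⟩ := hp
    exact ⟨p.rep, ⟨a, b, v, v', hab.symm⟩, p.rep_nonzero, p.mk_rep.symm⟩
  · rintro ⟨_, ⟨a, b, v, v', rfl⟩, hw, rfl⟩
    -- One of the two cone vectors may be zero and so define no projective point; the other one is
    -- then used twice.
    have key : ∀ (x y : Ambient k V s), x ∈ Set.range (conePoint k V s) →
        y ∈ Set.range (conePoint k V s) → x ≠ 0 → a • conePoint k V s v + b • conePoint k V s v' ∈
          Submodule.span k {x, y} → ∃ x ∈ projPoints (k := k) (Set.range (conePoint k V s)),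
          ∃ y ∈ projPoints (k := k) (Set.range (conePoint k V s)),
          (Projectivization.mk k _ hw).submodule ≤ x.submodule ⊔ y.submodule := by
      intro x y hx hy hx0 hmem
      by_cases hy0 : y = 0
      · refine ⟨_, mk_mem_projPoints hx hx0, _, mk_mem_projPoints hx hx0, ?_⟩
        rw [Projectivization.submodule_mk, Projectivization.submodule_mk, sup_idem,
          Submodule.span_singleton_le_iff_mem]
        rwa [hy0, Set.pair_comm, Submodule.span_insert_zero] at hmem
      · refine ⟨_, mk_mem_projPoints hx hx0, _, mk_mem_projPoints hy hy0, ?_⟩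
        rwa [Projectivization.submodule_mk, Projectivization.submodule_mk,
          Projectivization.submodule_mk, ← Submodule.span_union, Set.singleton_union,
          Submodule.span_singleton_le_iff_mem]
    by_cases hv : conePoint k V s v = 0
    · by_cases hv' : conePoint k V s v' = 0
      · exact absurd (by simp [hv, hv']) hw
      · exact key _ _ ⟨v', rfl⟩ ⟨v, rfl⟩ hv' (Submodule.mem_span_pair.2 ⟨b, a, add_comm _ _⟩)
    · exact key _ _ ⟨v, rfl⟩ ⟨v', rfl⟩ hv (Submodule.mem_span_pair.2 ⟨a, b, rfl⟩)

/-- Evaluation modulo `X ^ 2` depends only on the first-order jets of the arguments. -/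
theorem X_sq_dvd_aeval {W : Type*} [AddCommGroup W] [Module k W]
    {P Q : Module.Dual k W → Polynomial k} (h : ∀ φ, Polynomial.X ^ 2 ∣ P φ - Q φ)
    {f : MvPolynomial (Module.Dual k W) k} (hf : MvPolynomial.aeval Q f = 0) :
    Polynomial.X ^ 2 ∣ MvPolynomial.aeval P f := by
  rw [← Ideal.mem_span_singleton, ← Ideal.Quotient.eq_zero_iff_mem]
  have h1 : ∀ P : Module.Dual k W → Polynomial k,
      Ideal.Quotient.mk (Ideal.span {(Polynomial.X ^ 2 : Polynomial k)})
        (MvPolynomial.aeval P f) = MvPolynomial.aeval (fun φ =>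
          Ideal.Quotient.mkₐ k (Ideal.span {(Polynomial.X ^ 2 : Polynomial k)}) (P φ)) f :=
    fun P => MvPolynomial.comp_aeval_apply (φ := Ideal.Quotient.mkₐ k _) P f
  have h2 : (fun φ => Ideal.Quotient.mkₐ k (Ideal.span {(Polynomial.X ^ 2 : Polynomial k)}) (P φ)) =
      fun φ => Ideal.Quotient.mkₐ k (Ideal.span {(Polynomial.X ^ 2 : Polynomial k)}) (Q φ) := by
    funext φ
    exact Ideal.Quotient.eq.2 (Ideal.mem_span_singleton.2 (h φ))
  rw [h1, h2, ← h1, hf, map_zero]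

theorem eval_aeval_polynomial {W : Type*} [AddCommGroup W] [Module k W]
    (Q : Module.Dual k W → Polynomial k) (f : MvPolynomial (Module.Dual k W) k) {τ : k} {w : W}
    (h : ∀ φ, (Q φ).eval τ = φ w) : (MvPolynomial.aeval Q f).eval τ = polyEval f w := by
  induction f using MvPolynomial.induction_on with
  | C a => simp [polyEval]
  | add p q hp hq => rw [map_add, Polynomial.eval_add, hp, hq, polyEval_add]
  | mul_X p φ hp =>
    rw [map_mul, Polynomial.eval_mul, hp, MvPolynomial.aeval_X, h, polyEval_mul, polyEval_X]

/-- Homogeneous equations of the variety vanish on the whole cone. -/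
theorem polyEval_smul_conePoint [Nonempty (∀ i, {v : V i // v ≠ 0})] (hs : ∀ i, 0 < s i)
    {f : MvPolynomial (Module.Dual k (Ambient k V s)) k} {m : ℕ} (hf : f.IsHomogeneous m)
    (hfX : ∀ y ∈ variety k V s, VanishesAt f y) (a : k) (v : ∀ i, V i) :
    polyEval f (a • conePoint k V s v) = 0 := by
  rw [variety_eq_projPoints hs, forall_projPoints_vanishesAt_iff _ hf] at hfX
  · rw [polyEval_smul hf, hfX _ ⟨v, rfl⟩, mul_zero]
  · obtain ⟨v⟩ := ‹Nonempty (∀ i, {v : V i // v ≠ 0})›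
    exact ⟨_, mk_mem_projPoints (Set.mem_range_self fun i => (v i : V i))
      (conePoint_ne_zero fun i => (v i).2)⟩

/-- Let `a` and `b` be the scalars relating the given vectors to the chosen representatives. To
first order in τ, the line agrees with the curve `(a + b c τ) • conePoint (v + τ (b / a) u)`, which
stays in the cone. -/
theorem mem_tangentSpaceAt [Infinite k] (hs : ∀ i, 0 < s i) {v : ∀ i, V i} (hv : ∀ i, v i ≠ 0)
    (u : ∀ i, V i) (c : k) (hw : c • conePoint k V s v + tangentVector k s v u ≠ 0) :
    Projectivization.mk k _ hw ∈
      tangentSpaceAt (variety k V s)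
        (Projectivization.mk k _ (conePoint_ne_zero (k := k) (s := s) hv)) := by
  intro f m hf hfX
  have : Nonempty (∀ i, {v : V i // v ≠ 0}) := ⟨fun i => ⟨v i, hv i⟩⟩
  obtain ⟨a, ha⟩ := Projectivization.exists_smul_eq_mk_rep k _
    (conePoint_ne_zero (k := k) (s := s) hv)
  obtain ⟨b, hb⟩ := Projectivization.exists_smul_eq_mk_rep k _ hw
  rw [← ha, ← hb, Units.smul_def, Units.smul_def]
  obtain ⟨Q, hQ⟩ := exists_curve (k := k) (s := s) v (((b : k) / a) • u)
  refine X_sq_dvd_aeval (Q := fun φ => (Polynomial.C (a : k) +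
    Polynomial.C ((b : k) * c) * Polynomial.X) * Q φ) (fun φ => ?_) ?_
  · obtain ⟨-, h0, h1⟩ := hQ φ
    rw [Polynomial.X_pow_dvd_iff]
    intro d hd
    rw [tangentVector_smul] at h1
    interval_cases d
    · simp [Polynomial.mul_coeff_zero, h0]
    · rw [Polynomial.coeff_sub, Polynomial.coeff_add, Polynomial.coeff_C_mul_X, add_mul,
        Polynomial.coeff_add, mul_assoc, Polynomial.coeff_C_mul, Polynomial.coeff_C_mul,
        Polynomial.coeff_X_mul, h0, h1, Polynomial.coeff_C, if_neg one_ne_zero, if_pos rfl,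
        map_smul, map_add, map_smul, map_smul]
      simp only [smul_eq_mul]
      field_simp
      ring
  · refine Polynomial.funext fun τ => ?_
    rw [eval_aeval_polynomial (w := ((a : k) + b * c * τ) •
      conePoint k V s (v + τ • ((b : k) / a) • u)), polyEval_smul_conePoint hs hf hfX,
      Polynomial.eval_zero]
    intro φ
    simp [(hQ φ).1]

end Cones

/-! ### The embedded tangent spaces of the Segre–Veronese variety -/

section Tangent

variable {k : Type*} [Field k] {n : ℕ} {V : Fin n → Type*}
  [∀ i, AddCommGroup (V i)] [∀ i, Module k (V i)] {s : Fin n → ℕ}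

theorem exists_basis_apply_eq {M : Type*} [AddCommGroup M] [Module k M] {v : M} (hv : v ≠ 0) :
    ∃ (κ : Set M) (b : Module.Basis κ k M) (o : κ), b o = v := by
  have h : LinearIndepOn k id {v} := LinearIndepOn.singleton hv
  refine ⟨_, Module.Basis.extend h, ⟨v, h.subset_extend _ rfl⟩, ?_⟩
  rw [Module.Basis.extend_apply_self]

theorem restrictLine_X {W : Type*} [AddCommGroup W] [Module k W] (φ : Module.Dual k W) (w u : W) :
    restrictLine (MvPolynomial.X φ) w u =
      Polynomial.C (φ w) + Polynomial.C (φ u) * Polynomial.X :=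
  MvPolynomial.aeval_X _ _

theorem apply_eq_of_mem_tangentSpaceAt {W : Type*} [AddCommGroup W] [Module k W]
    {X : Set (ℙ k W)} {x p : ℙ k W} (hp : p ∈ tangentSpaceAt X x) {φ χ : Module.Dual k W}
    (h : ∀ y ∈ X, φ y.rep = χ y.rep) : φ p.rep = χ p.rep := by
  have h1 := hp (MvPolynomial.X φ - MvPolynomial.X χ) 1
    ((MvPolynomial.isHomogeneous_X _ _).sub (MvPolynomial.isHomogeneous_X _ _)) fun y hy => by
      simp [VanishesAt, polyEval, h y hy]
  rw [restrictLine, map_sub] at h1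
  change _ ∣ restrictLine _ _ _ - restrictLine _ _ _ at h1
  rw [restrictLine_X, restrictLine_X] at h1
  have h2 := Polynomial.X_pow_dvd_iff.1 h1 1 (by norm_num)
  simpa [Polynomial.coeff_C, sub_eq_zero] using h2

theorem quadric_of_mem_tangentSpaceAt {W : Type*} [AddCommGroup W] [Module k W]
    {X : Set (ℙ k W)} {x p : ℙ k W} (hp : p ∈ tangentSpaceAt X x) {φ χ φ' χ' : Module.Dual k W}
    (h : ∀ y ∈ X, φ y.rep * χ y.rep = φ' y.rep * χ' y.rep) :
    φ x.rep * χ p.rep + φ p.rep * χ x.rep = φ' x.rep * χ' p.rep + φ' p.rep * χ' x.rep := by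
  have h1 := hp (MvPolynomial.X φ * MvPolynomial.X χ - MvPolynomial.X φ' * MvPolynomial.X χ') 2
    (((MvPolynomial.isHomogeneous_X _ _).mul (MvPolynomial.isHomogeneous_X _ _)).sub
      ((MvPolynomial.isHomogeneous_X _ _).mul (MvPolynomial.isHomogeneous_X _ _)))
    fun y hy => by simp [VanishesAt, polyEval, h y hy]
  rw [restrictLine, map_sub, map_mul, map_mul] at h1
  change _ ∣ restrictLine _ _ _ * restrictLine _ _ _ -
    restrictLine _ _ _ * restrictLine _ _ _ at h1
  simp only [restrictLine_X] at h1
  have h2 := Polynomial.X_pow_dvd_iff.1 h1 1 (by norm_num)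
  have h3 : ∀ a b c d : k, ((Polynomial.C a + Polynomial.C b * Polynomial.X) *
      (Polynomial.C c + Polynomial.C d * Polynomial.X)).coeff 1 = a * d + b * c := by
    intro a b c d
    rw [add_mul, Polynomial.coeff_add, mul_assoc, Polynomial.coeff_C_mul, Polynomial.coeff_C_mul,
      Polynomial.coeff_X_mul]
    simp [Polynomial.coeff_C]
  rw [Polynomial.coeff_sub, h3, h3, sub_eq_zero] at h2
  exact h2

/-- In bases containing the `v i`, a few equations of the variety suffice. Linear forms comparing
slots of one factor show that coordinates off the base index in a single slot depend only on the
factor. Binomial quadrics, linearized at `x`, kill the coordinates off the base index in two slots.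
What remains is a derivative of the parametrization. -/
theorem rep_mem_tangentCone [∀ i, Module.Finite k (V i)] (hs : ∀ i, 0 < s i)
    {x p : ℙ k (Ambient k V s)} (hx : x ∈ variety k V s)
    (hp : p ∈ tangentSpaceAt (variety k V s) x) : p.rep ∈ tangentCone k V s := by
  classical
  obtain ⟨v, hv, hxv⟩ := hx
  choose κ b o hbo using fun i => exists_basis_apply_eq (k := k) (hv i)
  have : ∀ i, Finite (κ i) := fun i => Module.Finite.finite_basis (b i)
  have : ∀ i, Fintype (κ i) := fun i => Fintype.ofFinite _
  let B := Basis.piTensorProduct fun q : (Σ i : Fin n, Fin (s i)) => b q.1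
  let J₀ : ∀ q : (Σ i : Fin n, Fin (s i)), κ q.1 := fun q => o q.1
  let L : (∀ q : (Σ i : Fin n, Fin (s i)), κ q.1) → Module.Dual k (Ambient k V s) :=
    fun J => B.coord J
  have hL : ∀ J y, L J (PiTensorProduct.tprod k y) = ∏ q, (b q.1).repr (y q) (J q) := fun J y =>
    Basis.piTensorProduct_repr_tprod_apply _ _ _
  have hLc : ∀ J (v' : ∀ i, V i), L J (conePoint k V s v') =
    ∏ q : (Σ i : Fin n, Fin (s i)), (b q.1).repr (v' q.1) (J q) := fun J v' => hL _ _
  have hvo : ∀ i, (b i).repr (v i) = Finsupp.single (o i) 1 := fun i => by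
    rw [← hbo i, Module.Basis.repr_self]
  -- the coordinates of the point `v` of the cone
  have hL0 : L J₀ (conePoint k V s v) = 1 := by
    rw [hLc]
    exact Finset.prod_eq_one fun q _ => by rw [hvo]; simp [J₀]
  have hL1 : ∀ J q, J q ≠ o q.1 → L J (conePoint k V s v) = 0 := fun J q hq => by
    rw [hLc]
    exact Finset.prod_eq_zero (Finset.mem_univ q) (by rw [hvo]; simp [hq.symm])
  have hrep : ∀ y ∈ variety k V s, ∃ (a : k) (v' : ∀ i, V i), a ≠ 0 ∧
      y.rep = a • conePoint k V s v' := by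
    intro y hy
    rw [variety_eq_projPoints hs] at hy
    obtain ⟨_, ⟨v', rfl⟩, hw, rfl⟩ := hy
    obtain ⟨a, ha⟩ := Projectivization.exists_smul_eq_mk_rep k _ hw
    exact ⟨a, v', a.ne_zero, ha.symm⟩
  obtain ⟨a, ha0, ha⟩ : ∃ a : k, a ≠ 0 ∧ x.rep = a • conePoint k V s v := by
    have : x = Projectivization.mk k _ (conePoint_ne_zero (k := k) (s := s) hv) :=
      Projectivization.submodule_injective (by rw [hxv, Projectivization.submodule_mk])
    obtain ⟨a, ha⟩ := Projectivization.exists_smul_eq_mk_rep k _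
      (conePoint_ne_zero (k := k) (s := s) hv)
    exact ⟨a, a.ne_zero, by rw [this, ← ha]; rfl⟩
  have hsym : ∀ (i : Fin n) (r r' : Fin (s i)) (j : κ i),
      L (Function.update J₀ ⟨i, r⟩ j) p.rep = L (Function.update J₀ ⟨i, r'⟩ j) p.rep := by
    intro i r r' j
    refine apply_eq_of_mem_tangentSpaceAt hp fun y hy => ?_
    obtain ⟨c, v', -, hy⟩ := hrep y hy
    rw [hy, map_smul, map_smul, hLc, hLc]
    congr 1
    refine Fintype.prod_equiv (Equiv.swap (⟨i, r⟩ : Σ i : Fin n, Fin (s i)) ⟨i, r'⟩) _ _ fun q => ?_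
    by_cases h1 : q = ⟨i, r⟩
    · subst h1
      rw [Equiv.swap_apply_left, Function.update_self, Function.update_self]
    · by_cases h2 : q = ⟨i, r'⟩
      · subst h2
        rw [Equiv.swap_apply_right, Function.update_of_ne h1, Function.update_of_ne (Ne.symm h1)]
      · rw [Equiv.swap_apply_of_ne_of_ne h1 h2, Function.update_of_ne h1, Function.update_of_ne h2]
  have hquad : ∀ J q₁ q₂, q₁ ≠ q₂ → J q₁ ≠ o q₁.1 → J q₂ ≠ o q₂.1 → L J p.rep = 0 := by
    intro J q₁ q₂ hq h1 h2
    -- The quadric exchanges the index at `q₁` between `J₀` and `J`. Of its four coordinates only `L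
    -- J₀` is nonzero at `x`, so its linearization reads `a * L J p.rep = 0`.
    have h := quadric_of_mem_tangentSpaceAt hp (φ := L J₀) (χ := L J)
      (φ' := L (Function.update J₀ q₁ (J q₁))) (χ' := L (Function.update J q₁ (o q₁.1)))
      fun y hy => by
        obtain ⟨c, v', -, hy⟩ := hrep y hy
        rw [hy]
        simp only [map_smul, hLc, smul_eq_mul]
        rw [mul_mul_mul_comm, mul_mul_mul_comm c _ c, ← Finset.prod_mul_distrib,
          ← Finset.prod_mul_distrib]
        congr 1
        refine Finset.prod_congr rfl fun q _ => ?_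
        by_cases hqq : q = q₁
        · subst hqq
          simp [J₀, mul_comm]
        · simp [hqq]
    rw [ha] at h
    simp only [map_smul, hL0, hL1 J q₁ h1,
      hL1 (Function.update J₀ q₁ (J q₁)) q₁ (by simpa using h1),
      hL1 (Function.update J q₁ (o q₁.1)) q₂ (by simpa [hq.symm] using h2)] at h
    simpa [ha0] using h
  -- the tangent direction
  let u : ∀ i, V i := fun i => ∑ j, (if j = o i then 0 else
    L (Function.update J₀ ⟨i, ⟨0, hs i⟩⟩ j) p.rep) • b i j
  have hu : ∀ i j, (b i).repr (u i) j = if j = o i then 0 else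
      L (Function.update J₀ ⟨i, ⟨0, hs i⟩⟩ j) p.rep := fun i j => by
    rw [Module.Basis.repr_sum_self]
  refine ⟨L J₀ p.rep, v, u, hv, B.ext_elem fun J => ?_⟩
  change L J _ = L J _
  rw [map_add, map_smul, tangentVector_eq_sum, map_sum]
  simp only [hL]
  by_cases hJ : ∃ q₁, J q₁ ≠ o q₁.1
  · obtain ⟨q₁, h1⟩ := hJ
    rw [hL1 J q₁ h1, smul_zero, zero_add, Finset.sum_eq_single q₁]
    · by_cases hJ2 : ∃ q₂, q₁ ≠ q₂ ∧ J q₂ ≠ o q₂.1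
      · obtain ⟨q₂, hq, h2⟩ := hJ2
        rw [hquad J q₁ q₂ hq h1 h2, Finset.prod_eq_zero (Finset.mem_univ q₂)]
        rw [Function.update_of_ne hq.symm, hvo, Finsupp.single_eq_of_ne h2]
      · push Not at hJ2
        rw [Finset.prod_eq_single q₁]
        · rw [Function.update_self, hu, if_neg h1, hsym q₁.1 ⟨0, hs _⟩ q₁.2]
          congr 2
          funext q
          by_cases hq : q = q₁
          · subst hq
            rw [Function.update_self]
          · rw [Function.update_of_ne hq, hJ2 q (Ne.symm hq)]
        · intro q _ hq
          rw [Function.update_of_ne hq, hvo, hJ2 q (Ne.symm hq), Finsupp.single_eq_same]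
        · simp
    · intro q _ hq
      refine Finset.prod_eq_zero (Finset.mem_univ q₁) ?_
      rw [Function.update_of_ne hq.symm, hvo, Finsupp.single_eq_of_ne h1]
    · simp
  · push Not at hJ
    obtain rfl : J = J₀ := funext hJ
    rw [hL0, Finset.sum_eq_zero, smul_eq_mul, mul_one, add_zero]
    intro q _
    refine Finset.prod_eq_zero (Finset.mem_univ q) ?_
    rw [Function.update_self, hu, if_pos rfl]

theorem tangentialVariety_eq [Infinite k] [∀ i, Module.Finite k (V i)] (hs : ∀ i, 0 < s i) :
    tangentialVariety (variety k V s) = closure (projPoints (tangentCone k V s)) := by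
  unfold tangentialVariety
  congr 1
  ext p
  constructor
  · rintro ⟨x, hx, hp⟩
    exact ⟨p.rep, rep_mem_tangentCone hs hx hp, p.rep_nonzero, p.mk_rep.symm⟩
  · rintro ⟨_, ⟨a, v, u, hv, rfl⟩, hw, rfl⟩
    exact ⟨_, ⟨v, hv, Projectivization.submodule_mk _ _⟩, mem_tangentSpaceAt hs hv u a hw⟩

end Tangent

/-! ### Affine charts and upper bounds for the dimensions -/

section Charts

variable {k : Type*} [Field k] {n : ℕ} {V : Fin n → Type*}
  [∀ i, AddCommGroup (V i)] [∀ i, Module k (V i)] {s d : Fin n → ℕ}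
  (b : ∀ i, Module.Basis (Fin (d i + 1)) k (V i))

/-- The vector with affine coordinates `x` and vanishing zeroth coordinates. -/
noncomputable def dirVec (x : (Σ i : Fin n, Fin (d i)) → k) (i : Fin n) : V i :=
  ∑ j, x ⟨i, j⟩ • b i j.succ

/-- The vector with affine coordinates `x` and zeroth coordinates `1`. -/
noncomputable def chartVec (x : (Σ i : Fin n, Fin (d i)) → k) (i : Fin n) : V i :=
  b i 0 + dirVec b x i

theorem repr_dirVec_zero (x : (Σ i : Fin n, Fin (d i)) → k) (i : Fin n) :
    (b i).repr (dirVec b x i) 0 = 0 := by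
  simp [dirVec]

theorem repr_dirVec_succ (x : (Σ i : Fin n, Fin (d i)) → k) (i : Fin n) (j : Fin (d i)) :
    (b i).repr (dirVec b x i) j.succ = x ⟨i, j⟩ := by
  simp [dirVec, Finsupp.single_apply]

theorem repr_chartVec_zero (x : (Σ i : Fin n, Fin (d i)) → k) (i : Fin n) :
    (b i).repr (chartVec b x i) 0 = 1 := by
  simp [chartVec, repr_dirVec_zero]

theorem repr_chartVec_succ (x : (Σ i : Fin n, Fin (d i)) → k) (i : Fin n) (j : Fin (d i)) :
    (b i).repr (chartVec b x i) j.succ = x ⟨i, j⟩ := by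
  simp [chartVec, repr_dirVec_succ]

theorem chartVec_ne_zero (x : (Σ i : Fin n, Fin (d i)) → k) (i : Fin n) : chartVec b x i ≠ 0 := by
  intro h
  have := repr_chartVec_zero b x i
  simp [h] at this

theorem exists_dirVec {v : ∀ i, V i} (hv : ∀ i, (b i).repr (v i) 0 = 0) :
    ∃ x, v = dirVec b x := by
  refine ⟨fun q => (b q.1).repr (v q.1) q.2.succ, funext fun i => (b i).ext_elem fun j => ?_⟩
  refine Fin.cases ?_ (fun j => ?_) j
  · rw [hv, repr_dirVec_zero]
  · rw [repr_dirVec_succ]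

theorem exists_chartVec {v : ∀ i, V i} (hv : ∀ i, (b i).repr (v i) 0 ≠ 0) :
    ∃ x, v = fun i => (b i).repr (v i) 0 • chartVec b x i := by
  obtain ⟨x, hx⟩ := exists_dirVec b (v := fun i => ((b i).repr (v i) 0)⁻¹ • v i - b i 0)
    fun i => by simp [hv i]
  refine ⟨x, funext fun i => ?_⟩
  rw [chartVec, ← hx]
  simp [smul_smul, hv i]

theorem isPolyMap_dirVec {σ : Type*} (g : (Σ i : Fin n, Fin (d i)) → σ) (i : Fin n) :
    IsPolyMap fun t : σ → k => dirVec b (fun q => t (g q)) i := by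
  exact IsPolyMap.sum fun j _ => (isPolyMap_const (σ := σ) (b i j.succ)).coord_smul (g ⟨i, j⟩)

theorem isPolyMap_chartVec {σ : Type*} (g : (Σ i : Fin n, Fin (d i)) → σ) (i : Fin n) :
    IsPolyMap fun t : σ → k => chartVec b (fun q => t (g q)) i :=
  (isPolyMap_const _).add (isPolyMap_dirVec b g i)

section PolyMaps

variable [∀ i, Module.Finite k (V i)] {σ : Type*} {ψ χ : ∀ i, (σ → k) → V i}

theorem IsPolyMap.conePoint (hψ : ∀ i, IsPolyMap (ψ i)) :
    IsPolyMap fun t => conePoint k V s fun i => ψ i t :=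
  IsPolyMap.tprod (ψ := fun q : (Σ i : Fin n, Fin (s i)) => ψ q.1) fun q => hψ q.1

theorem IsPolyMap.tangentVector (hψ : ∀ i, IsPolyMap (ψ i)) (hχ : ∀ i, IsPolyMap (χ i)) :
    IsPolyMap fun t => tangentVector k s (fun i => ψ i t) (fun i => χ i t) := by
  simp only [tangentVector_eq_sum]
  refine IsPolyMap.sum fun q _ => ?_
  have h := IsPolyMap.tprod
    (ψ := Function.update (fun q : (Σ i : Fin n, Fin (s i)) => ψ q.1) q (χ q.1)) fun q' => by
      by_cases h : q' = q
      · subst h; simpa using hχ _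
      · simpa [h] using hψ _
  convert h using 3 with t
  funext q'
  by_cases h : q' = q
  · subst h; simp
  · simp [h]

theorem isPolyMap_conePoint_chartVec (g : (Σ i : Fin n, Fin (d i)) → σ) :
    IsPolyMap fun t : σ → k => conePoint k V s (chartVec b fun q => t (g q)) :=
  IsPolyMap.conePoint (ψ := fun i t => chartVec b (fun q => t (g q)) i) (isPolyMap_chartVec b g)

end PolyMaps

theorem nonempty_projPoints_of_chartVec {C : Set (Ambient k V s)}
    (h : ∀ x, conePoint k V s (chartVec b x) ∈ C) : (projPoints (k := k) C).Nonempty :=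
  ⟨_, mk_mem_projPoints (h 0) (conePoint_ne_zero (chartVec_ne_zero b 0))⟩

/-- Homogeneous equations can be checked on the chart where all zeroth coordinates are nonzero. -/
theorem polyEval_eq_zero_of_forall_chart [Infinite k] {W : Type*} [AddCommGroup W] [Module k W]
    {f : MvPolynomial (Module.Dual k W) k} {F : (∀ i, V i) → W} (v : ∀ i, V i)
    (hF : IsPolyMap fun t : Unit → k => F fun i => v i + t () • b i 0)
    (h : ∀ v : ∀ i, V i, (∀ i, (b i).repr (v i) 0 ≠ 0) → polyEval f (F v) = 0) :
    polyEval f (F v) = 0 := by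
  -- Where `G` does not vanish, the translate `v i + t • b i 0` lies in the chart for every `i`.
  let G : MvPolynomial Unit k := ∏ i, (MvPolynomial.C ((b i).repr (v i) 0) + MvPolynomial.X ())
  have hG : G ≠ 0 := by
    refine Finset.prod_ne_zero_iff.2 fun i _ h0 => ?_
    have h1 := congrArg (MvPolynomial.eval fun _ => 1 - (b i).repr (v i) 0) h0
    simp at h1
  have h1 := hF.polyEval_eq_zero hG (f := f) (fun t ht => h _ fun i => ?_) 0
  · simpa using h1
  · rw [map_prod, Finset.prod_ne_zero_iff] at ht
    simpa using ht i (Finset.mem_univ i)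

theorem isPolyMap_add_smul (v : ∀ i, V i) (i : Fin n) :
    IsPolyMap fun t : Unit → k => v i + t () • b i 0 :=
  (isPolyMap_const _).add ((isPolyMap_const (σ := Unit) (b i 0)).coord_smul ())

variable (s) in
/-- Parametrization of the cone over the variety. -/
noncomputable def coneParam (t : Option (Σ i : Fin n, Fin (d i)) → k) : Ambient k V s :=
  t none • conePoint k V s (chartVec b fun q => t (some q))

variable (s) in
/-- Parametrization of the cone over the secant variety. -/
noncomputable def secantParam
    (t : Option (Σ i : Fin n, Fin (d i)) ⊕ Option (Σ i : Fin n, Fin (d i)) → k) : Ambient k V s :=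
  coneParam s b (fun o => t (.inl o)) + coneParam s b fun o => t (.inr o)

variable (s) in
/-- Parametrization of the cone over the tangential variety. -/
noncomputable def tangentParam
    (t : Option ((Σ i : Fin n, Fin (d i)) ⊕ (Σ i : Fin n, Fin (d i))) → k) : Ambient k V s :=
  t none • conePoint k V s (chartVec b fun q => t (some (.inl q))) +
    tangentVector k s (chartVec b fun q => t (some (.inl q))) (dirVec b fun q => t (some (.inr q)))

theorem dirVec_smul (a : k) (x : (Σ i : Fin n, Fin (d i)) → k) :
    dirVec b (fun q => a * x q) = a • dirVec b x := by
  funext i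
  simp [dirVec, Finset.smul_sum, smul_smul]

theorem smul_coneParam_mem_range (a : k) (t : Option (Σ i : Fin n, Fin (d i)) → k) :
    ∃ t', coneParam s b t' = a • coneParam s b t :=
  ⟨fun o => o.elim (a * t none) fun q => t (some q), by simp [coneParam, smul_smul]⟩

variable [∀ i, Module.Finite k (V i)]

theorem isPolyMap_secantParam : IsPolyMap (secantParam s b) := by
  have h₁ := (isPolyMap_conePoint_chartVec (s := s) b
    (σ := Option (Σ i : Fin n, Fin (d i)) ⊕ Option (Σ i : Fin n, Fin (d i)))
    fun q => .inl (some q)).coord_smul (.inl none)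
  have h₂ := (isPolyMap_conePoint_chartVec (s := s) b
    (σ := Option (Σ i : Fin n, Fin (d i)) ⊕ Option (Σ i : Fin n, Fin (d i)))
    fun q => .inr (some q)).coord_smul (.inr none)
  exact h₁.add h₂

theorem isPolyMap_tangentParam : IsPolyMap (tangentParam s b) := by
  have h₁ := (isPolyMap_conePoint_chartVec (s := s) b
    (σ := Option ((Σ i : Fin n, Fin (d i)) ⊕ (Σ i : Fin n, Fin (d i))))
    fun q => some (.inl q)).coord_smul none
  have h₂ := IsPolyMap.tangentVector (s := s)
    (isPolyMap_chartVec b (σ := Option ((Σ i : Fin n, Fin (d i)) ⊕ (Σ i : Fin n, Fin (d i))))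
      fun q => some (.inl q)) (isPolyMap_dirVec b fun q => some (.inr q))
  exact h₁.add h₂

variable [Infinite k]

theorem variety_subset_closure (hs : ∀ i, 0 < s i) :
    variety k V s ⊆ closure (projPoints (Set.range (coneParam s b))) := by
  have hmem : ∀ x, conePoint k V s (chartVec b x) ∈ Set.range (coneParam s b) := fun x =>
    ⟨fun o => o.elim 1 x, by simp [coneParam]⟩
  rw [variety_eq_projPoints hs]
  refine subset_closure.trans (closure_projPoints_subset (nonempty_projPoints_of_chartVec b hmem)
    fun f m hf h => ?_)
  rintro _ ⟨v, rfl⟩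
  refine polyEval_eq_zero_of_forall_chart b (F := conePoint k V s) v
    (IsPolyMap.conePoint (isPolyMap_add_smul b v)) fun v hv => ?_
  obtain ⟨x, hx⟩ := exists_chartVec b hv
  rw [hx, conePoint_smul, polyEval_smul hf, h _ (hmem x), mul_zero]

theorem closure_secantCone_subset :
    closure (projPoints (secantCone k V s)) ⊆
      closure (projPoints (k := k) (Set.range (secantParam s b))) := by
  have hmem : ∀ a x a' x', a • conePoint k V s (chartVec b x) +
      a' • conePoint k V s (chartVec b x') ∈ Set.range (secantParam s b) := fun a x a' x' =>
    ⟨Sum.elim (fun o => o.elim a x) fun o => o.elim a' x', by simp [secantParam, coneParam]⟩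
  refine closure_projPoints_subset (nonempty_projPoints_of_chartVec b fun x => ?_)
    fun f m hf h => ?_
  · simpa using hmem 1 x 0 x
  rintro _ ⟨a, a', v, v', rfl⟩
  have hpoly : ∀ (a : k) (v : ∀ i, V i), IsPolyMap fun t : Unit → k =>
      a • conePoint k V s fun i => v i + t () • b i 0 := fun a v =>
    (IsPolyMap.conePoint (isPolyMap_add_smul b v)).const_smul a
  refine polyEval_eq_zero_of_forall_chart b
    (F := fun v => a • conePoint k V s v + a' • conePoint k V s v') v
    ((hpoly a v).add (isPolyMap_const _)) fun v hv => ?_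
  refine polyEval_eq_zero_of_forall_chart b
    (F := fun v' => a • conePoint k V s v + a' • conePoint k V s v') v'
    ((isPolyMap_const _).add (hpoly a' v')) fun v' hv' => ?_
  obtain ⟨x, hx⟩ := exists_chartVec b hv
  obtain ⟨x', hx'⟩ := exists_chartVec b hv'
  rw [hx, hx', conePoint_smul, conePoint_smul, smul_smul, smul_smul]
  exact h _ (hmem _ _ _ _)

/-- Rescaling the factors brings the base point into the chart. Multiples of `v i` are then removed
from the direction to kill its zeroth coordinates; by `tangentVector_smul_self` this changes only
the coefficient of the cone point. Without these redundant parameters, twice the sum of the `d i`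
plus one remain. -/
theorem closure_tangentCone_subset :
    closure (projPoints (tangentCone k V s)) ⊆
      closure (projPoints (k := k) (Set.range (tangentParam s b))) := by
  have hmem : ∀ a x y, a • conePoint k V s (chartVec b x) +
      tangentVector k s (chartVec b x) (dirVec b y) ∈ Set.range (tangentParam s b) := fun a x y =>
    ⟨fun o => o.elim a (Sum.elim x y), by simp [tangentParam]⟩
  refine closure_projPoints_subset (nonempty_projPoints_of_chartVec b fun x => ?_)
    fun f m hf h => ?_
  · have := hmem 1 x 0
    rwa [show dirVec b (0 : (Σ i : Fin n, Fin (d i)) → k) = 0 from funext fun i => by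
      simp [dirVec], tangentVector_zero, add_zero, one_smul] at this
  rintro _ ⟨a, v, u, -, rfl⟩
  refine polyEval_eq_zero_of_forall_chart b
    (F := fun v => a • conePoint k V s v + tangentVector k s v u) v (IsPolyMap.add
      ((IsPolyMap.conePoint (isPolyMap_add_smul b v)).const_smul a)
      (IsPolyMap.tangentVector (isPolyMap_add_smul b v) fun i => isPolyMap_const (u i)))
      fun v hv => ?_
  obtain ⟨x, hx⟩ := exists_chartVec b hv
  set g : Fin n → k := fun i => (b i).repr (v i) 0 with hg
  have hg0 : ∀ i, g i ≠ 0 := hv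
  obtain ⟨y, hy⟩ := exists_dirVec b (v := fun i => (g i)⁻¹ • u i -
    ((g i)⁻¹ * (b i).repr (u i) 0) • chartVec b x i) fun i => by simp [repr_chartVec_zero]
  have hu : u = fun i => g i • (fun i => ((g i)⁻¹ * (b i).repr (u i) 0) • chartVec b x i +
      dirVec b y i) i := by
    funext i
    beta_reduce
    rw [← hy]
    simp [smul_smul, hg0 i]
  have hx' : v = fun i => g i • chartVec b x i := hx
  have hsplit : (fun i => ((g i)⁻¹ * (b i).repr (u i) 0) • chartVec b x i + dirVec b y i) =
      (fun i => ((g i)⁻¹ * (b i).repr (u i) 0) • chartVec b x i) + dirVec b y := rfl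
  have key : a • conePoint k V s v + tangentVector k s v u ∈ Set.range (tangentParam s b) := by
    clear_value g
    rw [hx', conePoint_smul]
    nth_rewrite 1 [hu]
    rw [tangentVector_smul_smul, hsplit, tangentVector_add, tangentVector_smul_self, smul_add,
      ← add_assoc, smul_smul, smul_smul, ← add_smul, ← tangentVector_smul, ← dirVec_smul]
    exact hmem _ _ _
  exact h _ key

theorem topologicalKrullDim_variety_le
    (b : ∀ i, Module.Basis (Fin (d i + 1)) k (V i)) (hs : ∀ i, 0 < s i) :
    topologicalKrullDim (variety k V s) ≤ (∑ i, d i : ℕ) := by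
  refine topologicalKrullDim_le_of_subset_closure (ψ := coneParam s b)
    ((isPolyMap_conePoint_chartVec b fun q => some q).coord_smul none)
    (fun a t => smul_coneParam_mem_range b a t) (by simp) (variety_subset_closure b hs)

theorem topologicalKrullDim_secantVariety_le
    (b : ∀ i, Module.Basis (Fin (d i + 1)) k (V i)) (hs : ∀ i, 0 < s i) :
    topologicalKrullDim (secantVariety (variety k V s)) ≤ (2 * (∑ i, d i) + 1 : ℕ) := by
  rw [secantVariety_eq hs]
  refine topologicalKrullDim_le_of_subset_closure (isPolyMap_secantParam b) (fun a t => ?_)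
    (by simp; ring) (closure_secantCone_subset b)
  obtain ⟨t₁, h₁⟩ := smul_coneParam_mem_range (s := s) b a fun o => t (.inl o)
  obtain ⟨t₂, h₂⟩ := smul_coneParam_mem_range (s := s) b a fun o => t (.inr o)
  exact ⟨Sum.elim t₁ t₂, by simp [secantParam, h₁, h₂]⟩

theorem topologicalKrullDim_tangentialVariety_le
    (b : ∀ i, Module.Basis (Fin (d i + 1)) k (V i)) (hs : ∀ i, 0 < s i) :
    topologicalKrullDim (tangentialVariety (variety k V s)) ≤ (2 * (∑ i, d i) : ℕ) := by
  rw [tangentialVariety_eq hs]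
  refine topologicalKrullDim_le_of_subset_closure (isPolyMap_tangentParam b)
    (fun a t => ?_) (by simp; ring) (closure_tangentCone_subset b)
  refine ⟨fun o => o.elim (a * t none) (Sum.elim (fun q => t (some (.inl q)))
    fun q => a * t (some (.inr q))), ?_⟩
  simp [tangentParam, smul_smul, dirVec_smul, tangentVector_smul]

end Charts

/-! ### Inclusions between the variety, its tangents and its secants -/

section Inclusions

variable {k : Type*} [Field k] {n : ℕ} {V : Fin n → Type*}
  [∀ i, AddCommGroup (V i)] [∀ i, Module k (V i)] {s : Fin n → ℕ}

theorem variety_subset_tangentialVariety [Infinite k] [∀ i, Module.Finite k (V i)]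
    (hs : ∀ i, 0 < s i) : variety k V s ⊆ tangentialVariety (variety k V s) := by
  rw [tangentialVariety_eq hs]
  refine Set.Subset.trans ?_ subset_closure
  rintro p ⟨v, hv, hp⟩
  refine ⟨conePoint k V s v, ⟨1, v, 0, hv, by simp [tangentVector_zero]⟩, conePoint_ne_zero hv,
    Projectivization.submodule_injective ?_⟩
  rw [hp, Projectivization.submodule_mk]

/-- Tangent vectors are limits of secant vectors. -/
theorem tangentialVariety_subset_secantVariety [Infinite k] [∀ i, Module.Finite k (V i)]
    (hs : ∀ i, 0 < s i) (hV : ∀ i, ∃ v : V i, v ≠ 0) :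
    tangentialVariety (variety k V s) ⊆ secantVariety (variety k V s) := by
  rw [tangentialVariety_eq hs, secantVariety_eq hs]
  choose v₀ hv₀ using hV
  have hmem : conePoint k V s v₀ ∈ secantCone k V s := ⟨1, 0, v₀, v₀, by simp⟩
  refine closure_projPoints_subset ⟨_, mk_mem_projPoints hmem (conePoint_ne_zero hv₀)⟩
    fun f m hf h => ?_
  rintro _ ⟨a, v, u, -, rfl⟩
  obtain ⟨Q, hQ⟩ := exists_curve (k := k) (s := s) v u
  -- The coordinates of `(conePoint (v + τ u) - conePoint v) / τ + a • conePoint v`: a secant vector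
  -- for τ ≠ 0, the given tangent vector at τ = 0. Multiplying by `X` below disposes of the value τ
  -- = 0.
  let R : Module.Dual k (Ambient k V s) → Polynomial k := fun φ =>
    (Q φ).divX + Polynomial.C (a * φ (conePoint k V s v))
  have hR : MvPolynomial.aeval R f = 0 := by
    refine (mul_eq_zero.1 (Polynomial.funext fun τ => ?_ : Polynomial.X * MvPolynomial.aeval R f =
      0)).resolve_left Polynomial.X_ne_zero
    rw [Polynomial.eval_mul, Polynomial.eval_X, Polynomial.eval_zero, mul_eq_zero]
    refine or_iff_not_imp_left.2 fun hτ => ?_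
    rw [eval_aeval_polynomial (w := τ⁻¹ • conePoint k V s (v + τ • u) +
      (a - τ⁻¹) • conePoint k V s v) R f]
    · exact h _ ⟨_, _, _, _, rfl⟩
    · intro φ
      obtain ⟨h0, h1, -⟩ := hQ φ
      have h2 := congrArg (Polynomial.eval τ) (Polynomial.divX_mul_X_add (Q φ))
      rw [h0, Polynomial.eval_add, Polynomial.eval_mul, Polynomial.eval_X, Polynomial.eval_C,
        h1] at h2
      simp only [R, Polynomial.eval_add, Polynomial.eval_C, map_add, map_smul, smul_eq_mul, ← h2]
      field_simp
      ring
  rw [← eval_aeval_polynomial (τ := 0) R f, hR, Polynomial.eval_zero]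
  intro φ
  simp only [R, Polynomial.eval_add, Polynomial.eval_C, map_add, map_smul, smul_eq_mul,
    ← Polynomial.coeff_zero_eq_eval_zero, Polynomial.coeff_divX, zero_add, (hQ φ).2.2]
  ring

end Inclusions

/-! ### Contractions and lower bounds for the dimensions -/

section LowerBounds

variable {k : Type*} [Field k] {n : ℕ} {V : Fin n → Type*}
  [∀ i, AddCommGroup (V i)] [∀ i, Module k (V i)] {s d : Fin n → ℕ}
  (b : ∀ i, Module.Basis (Fin (d i + 1)) k (V i))

variable (s) in
/-- The slots of the ambient tensor product whose factor is not a line. -/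
def nontrivialSlots (d : Fin n → ℕ) : Finset (Σ i : Fin n, Fin (s i)) :=
  Finset.univ.filter fun q => 0 < d q.1

/-- Contraction with the linear forms `α`, `β`, `γ` in three slots and with the zeroth coordinate
in all others. -/
noncomputable def contract (q₁ q₂ q₃ : Σ i : Fin n, Fin (s i)) (α : Module.Dual k (V q₁.1))
    (β : Module.Dual k (V q₂.1)) (γ : Module.Dual k (V q₃.1)) : Module.Dual k (Ambient k V s) :=
  PiTensorProduct.dualDistrib (PiTensorProduct.tprod k
    (Function.update (Function.update (Function.update
      (fun q : (Σ i : Fin n, Fin (s i)) => (b q.1).coord 0) q₁ α) q₂ β) q₃ γ))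

variable {q₁ q₂ q₃ : Σ i : Fin n, Fin (s i)}
  (α : Module.Dual k (V q₁.1)) (β : Module.Dual k (V q₂.1)) (γ : Module.Dual k (V q₃.1))

theorem contract_conePoint (h₁₂ : q₁ ≠ q₂) (h₁₃ : q₁ ≠ q₃) (h₂₃ : q₂ ≠ q₃) {v : ∀ i, V i}
    (hv : ∀ i, (b i).repr (v i) 0 = 1) :
    contract b q₁ q₂ q₃ α β γ (conePoint k V s v) = α (v q₁.1) * β (v q₂.1) * γ (v q₃.1) := by
  refine (PiTensorProduct.dualDistrib_apply _ _).trans ?_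
  rw [← Finset.prod_subset (Finset.subset_univ {q₁, q₂, q₃}),
    Finset.prod_insert (by simp [h₁₂, h₁₃]), Finset.prod_insert (by simp [h₂₃]),
    Finset.prod_singleton]
  · simp [h₁₂, h₁₃, h₂₃, mul_assoc]
  · intro q _ hq
    simp only [Finset.mem_insert, Finset.mem_singleton, not_or] at hq
    rw [Function.update_of_ne hq.2.2, Function.update_of_ne hq.2.1, Function.update_of_ne hq.1]
    exact hv q.1

/-- Leibniz rule: along `v + τ u` the contraction is a product of three affine functions of τ, since
all other slots contribute 1. -/
theorem contract_tangentVector [Infinite k] (h₁₂ : q₁ ≠ q₂) (h₁₃ : q₁ ≠ q₃) (h₂₃ : q₂ ≠ q₃)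
    {v u : ∀ i, V i} (hv : ∀ i, (b i).repr (v i) 0 = 1) (hu : ∀ i, (b i).repr (u i) 0 = 0) :
    contract b q₁ q₂ q₃ α β γ (tangentVector k s v u) =
      α (u q₁.1) * β (v q₂.1) * γ (v q₃.1) + α (v q₁.1) * β (u q₂.1) * γ (v q₃.1) +
        α (v q₁.1) * β (v q₂.1) * γ (u q₃.1) := by
  obtain ⟨Q, hQ⟩ := exists_curve (k := k) (s := s) v u
  obtain ⟨hQ, -, h1⟩ := hQ (contract b q₁ q₂ q₃ α β γ)
  have hP : Q (contract b q₁ q₂ q₃ α β γ) =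
      (Polynomial.C (α (v q₁.1)) + Polynomial.C (α (u q₁.1)) * Polynomial.X) *
      (Polynomial.C (β (v q₂.1)) + Polynomial.C (β (u q₂.1)) * Polynomial.X) *
      (Polynomial.C (γ (v q₃.1)) + Polynomial.C (γ (u q₃.1)) * Polynomial.X) := by
    refine Polynomial.funext fun τ => ?_
    rw [hQ, contract_conePoint b α β γ h₁₂ h₁₃ h₂₃ fun i => by simp [hv, hu]]
    simp [mul_comm τ]
  have hcoeff : ∀ p : Polynomial k, p.coeff 1 = p.derivative.eval 0 := fun p => by
    rw [← Polynomial.coeff_zero_eq_eval_zero, Polynomial.coeff_derivative]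
    simp
  rw [← h1, hP, hcoeff]
  simp
  ring

theorem card_le_topologicalKrullDim_variety [Infinite k] [∀ i, Module.Finite k (V i)]
    (b : ∀ i, Module.Basis (Fin (d i + 1)) k (V i)) (hs : ∀ i, 0 < s i) :
    ((∑ i, d i : ℕ) : WithBot ℕ∞) ≤ topologicalKrullDim (variety k V s) := by
  have hcard : Fintype.card (Σ i : Fin n, Fin (d i)) = ∑ i, d i := by simp
  rw [← hcard]
  refine card_le_topologicalKrullDim
    (ψ := fun x => conePoint k V s (chartVec b x)) (isPolyMap_conePoint_chartVec b id)
    (fun x => conePoint_ne_zero (chartVec_ne_zero b x)) 0 (fun q => ?_) ?_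
  · let q' : Σ i : Fin n, Fin (s i) := ⟨q.1, ⟨0, hs q.1⟩⟩
    let L : Module.Dual k (Ambient k V s) := PiTensorProduct.dualDistrib (PiTensorProduct.tprod k
      (Function.update (fun q : (Σ i : Fin n, Fin (s i)) => (b q.1).coord 0) q'
        ((b q.1).coord q.2.succ)))
    have hL : ∀ x, L (conePoint k V s (chartVec b x)) = x q := by
      intro x
      refine (PiTensorProduct.dualDistrib_apply _ _).trans ?_
      rw [Finset.prod_eq_single q']
      · rw [Function.update_self]
        exact repr_chartVec_succ b x q.1 q.2
      · intro p _ hp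
        rw [Function.update_of_ne hp]
        exact repr_chartVec_zero b x p.1
      · simp
    refine ⟨MvPolynomial.X L, 1, MvPolynomial.isHomogeneous_X _ _, fun x hx => ?_, 1, ?_⟩
    · rw [polyEval_X, hL, hx, Pi.zero_apply]
    · rw [polyEval_X, hL, Function.update_self]
      exact one_ne_zero
  · rw [variety_eq_projPoints hs]
    rintro _ ⟨_, ⟨x, rfl⟩, hw, rfl⟩
    exact ⟨_, ⟨_, rfl⟩, hw, rfl⟩

variable (q₁ q₂ q₃) in
/-- The entries of the contraction of a tensor to three slots. -/
noncomputable def entry (m₁ : Fin (d q₁.1 + 1)) (m₂ : Fin (d q₂.1 + 1)) (m₃ : Fin (d q₃.1 + 1)) :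
    Module.Dual k (Ambient k V s) :=
  contract b q₁ q₂ q₃ ((b q₁.1).coord m₁) ((b q₂.1).coord m₂) ((b q₃.1).coord m₃)

theorem entry_conePoint (h₁₂ : q₁ ≠ q₂) (h₁₃ : q₁ ≠ q₃) (h₂₃ : q₂ ≠ q₃)
    (m₁ : Fin (d q₁.1 + 1)) (m₂ : Fin (d q₂.1 + 1)) (m₃ : Fin (d q₃.1 + 1))
    (x : (Σ i : Fin n, Fin (d i)) → k) :
    entry b q₁ q₂ q₃ m₁ m₂ m₃ (conePoint k V s (chartVec b x)) =
      (b _).repr (chartVec b x q₁.1) m₁ * (b _).repr (chartVec b x q₂.1) m₂ *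
        (b _).repr (chartVec b x q₃.1) m₃ :=
  contract_conePoint b _ _ _ h₁₂ h₁₃ h₂₃ (repr_chartVec_zero b x)

theorem entry_tangentVector [Infinite k] (h₁₂ : q₁ ≠ q₂) (h₁₃ : q₁ ≠ q₃) (h₂₃ : q₂ ≠ q₃)
    (m₁ : Fin (d q₁.1 + 1)) (m₂ : Fin (d q₂.1 + 1)) (m₃ : Fin (d q₃.1 + 1))
    (x u : (Σ i : Fin n, Fin (d i)) → k) :
    entry b q₁ q₂ q₃ m₁ m₂ m₃ (tangentVector k s (chartVec b x) (dirVec b u)) =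
      (b _).repr (dirVec b u q₁.1) m₁ * (b _).repr (chartVec b x q₂.1) m₂ *
        (b _).repr (chartVec b x q₃.1) m₃ +
      (b _).repr (chartVec b x q₁.1) m₁ * (b _).repr (dirVec b u q₂.1) m₂ *
        (b _).repr (chartVec b x q₃.1) m₃ +
      (b _).repr (chartVec b x q₁.1) m₁ * (b _).repr (chartVec b x q₂.1) m₂ *
        (b _).repr (dirVec b u q₃.1) m₃ :=
  contract_tangentVector b _ _ _ h₁₂ h₁₃ h₂₃ (repr_chartVec_zero b x) (repr_dirVec_zero b u)

/-- Cayley's hyperdeterminant of a `2 × 2 × 2` array of linear forms. -/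
noncomputable def hyperdet {W : Type*} [AddCommGroup W] [Module k W]
    (a₀₀₀ a₀₀₁ a₀₁₀ a₀₁₁ a₁₀₀ a₁₀₁ a₁₁₀ a₁₁₁ : Module.Dual k W) :
    MvPolynomial (Module.Dual k W) k :=
  (.X a₀₀₀ * .X a₁₁₁ + .X a₁₀₀ * .X a₀₁₁ - .X a₀₀₁ * .X a₁₁₀ - .X a₁₀₁ * .X a₀₁₀) ^ 2 -
    .C 4 * ((.X a₀₀₀ * .X a₀₁₁ - .X a₀₀₁ * .X a₀₁₀) * (.X a₁₀₀ * .X a₁₁₁ - .X a₁₀₁ * .X a₁₁₀))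

theorem isHomogeneous_hyperdet {W : Type*} [AddCommGroup W] [Module k W]
    (a₀₀₀ a₀₀₁ a₀₁₀ a₀₁₁ a₁₀₀ a₁₀₁ a₁₁₀ a₁₁₁ : Module.Dual k W) :
    (hyperdet a₀₀₀ a₀₀₁ a₀₁₀ a₀₁₁ a₁₀₀ a₁₀₁ a₁₁₀ a₁₁₁).IsHomogeneous 4 := by
  have h : ∀ φ χ : Module.Dual k W,
      (.X φ * .X χ : MvPolynomial (Module.Dual k W) k).IsHomogeneous 2 := fun φ χ =>
    (MvPolynomial.isHomogeneous_X _ _).mul (MvPolynomial.isHomogeneous_X _ _)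
  exact (((((h _ _).add (h _ _)).sub (h _ _)).sub (h _ _)).pow 2).sub
    ((((h _ _).sub (h _ _)).mul ((h _ _).sub (h _ _))).C_mul 4)

/-- With at least three nontrivial slots, the hyperdeterminant separates secants from tangents. -/
theorem secantVariety_ne_tangentialVariety [Infinite k] [∀ i, Module.Finite k (V i)]
    (b : ∀ i, Module.Basis (Fin (d i + 1)) k (V i)) (hs : ∀ i, 0 < s i)
    (hQ : 3 ≤ (nontrivialSlots s d).card) :
    secantVariety (variety k V s) ≠ tangentialVariety (variety k V s) := by
  obtain ⟨q₁, q₂, q₃, hq₁, hq₂, hq₃, h₁₂, h₁₃, h₂₃⟩ := Finset.two_lt_card_iff.1 hQ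
  simp only [nontrivialSlots, Finset.mem_filter, Finset.mem_univ, true_and] at hq₁ hq₂ hq₃
  let j₁ : Fin (d q₁.1) := ⟨0, hq₁⟩
  let j₂ : Fin (d q₂.1) := ⟨0, hq₂⟩
  let j₃ : Fin (d q₃.1) := ⟨0, hq₃⟩
  let E : Fin (d q₁.1 + 1) → Fin (d q₂.1 + 1) → Fin (d q₃.1 + 1) →
    Module.Dual k (Ambient k V s) := entry b q₁ q₂ q₃
  -- The hyperdeterminant is the discriminant of the determinant of the pencil of slices in slot
  -- `q₁`. For a tangent, that binary quadratic form is a constant times the square of a linear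
  -- form; for a sum of two general points, it has two distinct roots.
  let F := hyperdet (E 0 0 0) (E 0 0 j₃.succ) (E 0 j₂.succ 0) (E 0 j₂.succ j₃.succ)
    (E j₁.succ 0 0) (E j₁.succ 0 j₃.succ) (E j₁.succ j₂.succ 0) (E j₁.succ j₂.succ j₃.succ)
  have hF : F.IsHomogeneous 4 := isHomogeneous_hyperdet _ _ _ _ _ _ _ _
  -- The resulting array has entry 2 at 000 and 1 elsewhere, so its hyperdeterminant is 1.
  let w := conePoint k V s (chartVec b 0) + conePoint k V s (chartVec b 1)
  have hFw : polyEval F w = 1 := by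
    simp only [F, hyperdet, polyEval, E, w, map_sub, map_add, map_mul, map_pow,
      MvPolynomial.eval_X, MvPolynomial.eval_C, entry_conePoint b h₁₂ h₁₃ h₂₃,
      repr_chartVec_zero, repr_chartVec_succ, Pi.zero_apply, Pi.one_apply]
    norm_num
  have hw : w ≠ 0 := by
    intro h
    have : polyEval F w = 0 := by
      rw [h, ← zero_smul k (0 : Ambient k V s), polyEval_smul hF]
      simp
    exact one_ne_zero (hFw.symm.trans this)
  intro heq
  have hmem : Projectivization.mk k w hw ∈ secantVariety (variety k V s) := by
    rw [secantVariety_eq hs]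
    exact subset_closure ⟨w, ⟨1, 1, chartVec b 0, chartVec b 1, by simp [w]⟩, hw, rfl⟩
  rw [heq, tangentialVariety_eq hs] at hmem
  have hv := mem_closure_iff_vanishesAt.1 (closure_tangentCone_subset b hmem) F 4 hF ?_
  · rw [vanishesAt_mk_iff hF, hFw] at hv
    exact one_ne_zero hv
  · rintro _ ⟨_, ⟨t, rfl⟩, hw, rfl⟩
    rw [vanishesAt_mk_iff hF]
    simp only [F, hyperdet, polyEval, E, tangentParam, map_sub, map_add, map_mul, map_pow, map_smul,
      MvPolynomial.eval_X, MvPolynomial.eval_C, entry_conePoint b h₁₂ h₁₃ h₂₃,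
      entry_tangentVector b h₁₂ h₁₃ h₂₃, repr_chartVec_zero, repr_chartVec_succ,
      repr_dirVec_zero, repr_dirVec_succ, smul_eq_mul]
    ring

/-- A cubic in the entries of a `2 × 2 × 2` array built from the third cumulant. -/
noncomputable def cumulantCubic {W : Type*} [AddCommGroup W] [Module k W]
    (a₀₀₀ a₀₀₁ a₀₁₀ a₀₁₁ a₁₀₀ a₁₀₁ a₁₁₀ a₁₁₁ : Module.Dual k W) :
    MvPolynomial (Module.Dual k W) k :=
  .X a₀₀₀ * .X a₀₀₀ * .X a₁₁₁ - .X a₀₀₀ * .X a₁₀₀ * .X a₀₁₁ - .X a₀₀₀ * .X a₀₁₀ * .X a₁₀₁ -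
    .X a₀₀₀ * .X a₀₀₁ * .X a₁₁₀ + .C 2 * (.X a₁₀₀ * .X a₀₁₀ * .X a₀₀₁) +
    .C 2 * (.X a₀₀₀ * .X a₀₀₀ * .X a₀₁₁ - .X a₀₀₀ * .X a₀₁₀ * .X a₀₀₁)

theorem isHomogeneous_cumulantCubic {W : Type*} [AddCommGroup W] [Module k W]
    (a₀₀₀ a₀₀₁ a₀₁₀ a₀₁₁ a₁₀₀ a₁₀₁ a₁₁₀ a₁₁₁ : Module.Dual k W) :
    (cumulantCubic a₀₀₀ a₀₀₁ a₀₁₀ a₀₁₁ a₁₀₀ a₁₀₁ a₁₁₀ a₁₁₁).IsHomogeneous 3 := by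
  have h : ∀ φ χ ω : Module.Dual k W,
      (.X φ * .X χ * .X ω : MvPolynomial (Module.Dual k W) k).IsHomogeneous 3 := fun φ χ ω =>
    ((MvPolynomial.isHomogeneous_X _ _).mul (MvPolynomial.isHomogeneous_X _ _)).mul
      (MvPolynomial.isHomogeneous_X _ _)
  exact (((((h _ _ _).sub (h _ _ _)).sub (h _ _ _)).sub (h _ _ _)).add ((h _ _ _).C_mul 2)).add
    (((h _ _ _).sub (h _ _ _)).C_mul 2)

variable (s) in
/-- The tangent vectors with zeroth coordinate `1`, parametrized by their first order coordinates
(the left summand) and their direction (the right summand). -/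
noncomputable def affineTangent
    (t : (Σ i : Fin n, Fin (d i)) ⊕ (Σ i : Fin n, Fin (d i)) → k) : Ambient k V s :=
  conePoint k V s (chartVec b fun q => t (.inl q) - t (.inr q)) +
    tangentVector k s (chartVec b fun q => t (.inl q) - t (.inr q)) (dirVec b fun q => t (.inr q))

theorem isPolyMap_affineTangent [∀ i, Module.Finite k (V i)] : IsPolyMap (affineTangent s b) := by
  have h := (isPolyMap_tangentParam (s := s) b).comp (τ := (Σ i : Fin n, Fin (d i)) ⊕
    (Σ i : Fin n, Fin (d i))) fun o => o.elim 1 (Sum.elim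
      (fun q => .X (.inl q) - .X (.inr q)) fun q => .X (.inr q))
  simp only [tangentParam, Option.elim_none, Option.elim_some, Sum.elim_inl, Sum.elim_inr, map_one,
    map_sub, MvPolynomial.eval_X, one_smul] at h
  exact h

theorem two_mul_le_topologicalKrullDim_tangentialVariety [CharZero k]
    [∀ i, Module.Finite k (V i)]
    (b : ∀ i, Module.Basis (Fin (d i + 1)) k (V i)) (hs : ∀ i, 0 < s i)
    (hQ : 3 ≤ (nontrivialSlots s d).card) :
    ((2 * ∑ i, d i : ℕ) : WithBot ℕ∞) ≤
      topologicalKrullDim (tangentialVariety (variety k V s)) := by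
  have hcard : Fintype.card ((Σ i : Fin n, Fin (d i)) ⊕ (Σ i : Fin n, Fin (d i))) =
      2 * ∑ i, d i := by
    simp [two_mul]
  rw [← hcard]
  refine card_le_topologicalKrullDim (isPolyMap_affineTangent (s := s) b) (fun t h => ?_)
    -- The frozen directions are 1 rather than 0, because the cubic detecting one direction
    -- coordinate has two others as factors.
    (Sum.elim 0 1) ?_ ?_
  · obtain ⟨q₁, q₂, q₃, -, -, -, h₁₂, h₁₃, h₂₃⟩ := Finset.two_lt_card_iff.1 hQ
    have h1 : entry b q₁ q₂ q₃ 0 0 0 (affineTangent s b t) = 1 := by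
      simp [affineTangent, entry_conePoint b h₁₂ h₁₃ h₂₃, entry_tangentVector b h₁₂ h₁₃ h₂₃,
        repr_chartVec_zero, repr_dirVec_zero]
    rw [h, map_zero] at h1
    exact zero_ne_one h1
  · intro p
    obtain ⟨q, hq⟩ : ∃ q, p = .inl q ∨ p = .inr q := by
      rcases p with q | q
      exacts [⟨q, .inl rfl⟩, ⟨q, .inr rfl⟩]
    let q₁ : Σ i : Fin n, Fin (s i) := ⟨q.1, ⟨0, hs q.1⟩⟩
    have hq₁ : q₁ ∈ nontrivialSlots s d :=
      Finset.mem_filter.2 ⟨Finset.mem_univ _, Nat.zero_lt_of_lt q.2.2⟩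
    obtain ⟨q₂, hq₂, q₃, hq₃, h₂₃⟩ := Finset.one_lt_card.1
      (show 1 < ((nontrivialSlots s d).erase q₁).card by
        rw [Finset.card_erase_of_mem hq₁]; omega)
    rw [Finset.mem_erase] at hq₂ hq₃
    have h₁₂ : q₁ ≠ q₂ := hq₂.1.symm
    have h₁₃ : q₁ ≠ q₃ := hq₃.1.symm
    let j₁ : Fin (d q₁.1) := q.2
    let j₂ : Fin (d q₂.1) := ⟨0, (Finset.mem_filter.1 hq₂.2).2⟩
    let j₃ : Fin (d q₃.1) := ⟨0, (Finset.mem_filter.1 hq₃.2).2⟩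
    let E : Fin (d q₁.1 + 1) → Fin (d q₂.1 + 1) → Fin (d q₃.1 + 1) →
      Module.Dual k (Ambient k V s) := entry b q₁ q₂ q₃
    have hqj : (⟨q₁.1, j₁⟩ : Σ i : Fin n, Fin (d i)) = q := rfl
    rcases hq with rfl | rfl
    · have hE : ∀ t, E j₁.succ 0 0 (affineTangent s b t) = t (.inl q) := by
        intro t
        simp only [E, affineTangent, map_add, entry_conePoint b h₁₂ h₁₃ h₂₃,
          entry_tangentVector b h₁₂ h₁₃ h₂₃, repr_chartVec_zero, repr_chartVec_succ,
          repr_dirVec_zero, repr_dirVec_succ, hqj]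
        ring
      refine ⟨.X (E j₁.succ 0 0), 1, MvPolynomial.isHomogeneous_X _ _, fun t ht => ?_, 1, ?_⟩
      · rw [polyEval_X, hE, ht]
        rfl
      · rw [polyEval_X, hE, Function.update_self]
        exact one_ne_zero
    -- The 000 entry is 1, and the entries behave like moments whose means are the left parameters.
    -- With direction u, the covariances are -uᵢuⱼ and the third cumulant is 2u₁u₂u₃. Adding twice
    -- the covariance of slots two and three gives 2u₂u₃(u₁ - 1), which detects u₁ = 1.
    · let F := cumulantCubic (E 0 0 0) (E 0 0 j₃.succ) (E 0 j₂.succ 0) (E 0 j₂.succ j₃.succ)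
        (E j₁.succ 0 0) (E j₁.succ 0 j₃.succ) (E j₁.succ j₂.succ 0) (E j₁.succ j₂.succ j₃.succ)
      have hF : ∀ t, polyEval F (affineTangent s b t) =
          2 * t (.inr ⟨q₂.1, j₂⟩) * t (.inr ⟨q₃.1, j₃⟩) * (t (.inr q) - 1) := by
        intro t
        simp only [F, cumulantCubic, polyEval, E, affineTangent, map_sub, map_add, map_mul,
          MvPolynomial.eval_X, MvPolynomial.eval_C, entry_conePoint b h₁₂ h₁₃ h₂₃,
          entry_tangentVector b h₁₂ h₁₃ h₂₃, repr_chartVec_zero, repr_chartVec_succ,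
          repr_dirVec_zero, repr_dirVec_succ, hqj]
        ring
      refine ⟨F, 3, isHomogeneous_cumulantCubic _ _ _ _ _ _ _ _, fun t ht => ?_, 2, ?_⟩
      · rw [hF, ht]
        simp
      -- The other two slots may belong to the same factor and refer to the updated coordinate
      -- itself, so both values 1 and 2 occur.
      · have hne : ∀ p, Function.update (Sum.elim 0 1 : (Σ i : Fin n, Fin (d i)) ⊕
            (Σ i : Fin n, Fin (d i)) → k) (.inr q) 2 (.inr p) ≠ 0 := by
          intro p
          rw [Function.update_apply]
          split_ifs <;> simp
        rw [hF, Function.update_self]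
        refine mul_ne_zero (mul_ne_zero (mul_ne_zero two_ne_zero (hne _)) (hne _)) ?_
        norm_num
  · rw [tangentialVariety_eq hs]
    refine Set.Subset.trans ?_ subset_closure
    rintro _ ⟨_, ⟨t, rfl⟩, hw, rfl⟩
    exact ⟨_, ⟨1, _, _, chartVec_ne_zero b _, by rw [one_smul]; rfl⟩, hw, rfl⟩

theorem isIrreducible_secantVariety [Infinite k] [∀ i, Module.Finite k (V i)]
    (b : ∀ i, Module.Basis (Fin (d i + 1)) k (V i)) (hs : ∀ i, 0 < s i) :
    IsIrreducible (secantVariety (variety k V s)) := by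
  have h : secantVariety (variety k V s) =
      closure (projPoints (k := k) (Set.range (secantParam s b))) := by
    rw [secantVariety_eq hs]
    refine (closure_secantCone_subset b).antisymm (closure_mono ?_)
    rintro _ ⟨_, ⟨t, rfl⟩, hw, rfl⟩
    exact ⟨_, ⟨_, _, _, _, rfl⟩, hw, rfl⟩
  rw [h]
  refine (isIrreducible_projPoints_range (isPolyMap_secantParam b)
    (nonempty_projPoints_of_chartVec b fun x => ?_)).closure
  exact ⟨Sum.elim (fun o => o.elim 1 x) fun o => o.elim 0 x, by simp [secantParam, coneParam]⟩

end LowerBounds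

/-! ### The case of at most two nontrivial slots -/

section Degenerate

variable {k : Type*} [Field k] {n : ℕ} {V : Fin n → Type*}
  [∀ i, AddCommGroup (V i)] [∀ i, Module k (V i)] {s d : Fin n → ℕ}

theorem mem_nontrivialSlots {q : Σ i : Fin n, Fin (s i)} :
    q ∈ nontrivialSlots s d ↔ 0 < d q.1 := by
  simp [nontrivialSlots]

theorem tangentVector_eq_sum_nontrivialSlots (v : ∀ i, V i) {u : ∀ i, V i}
    (hu : ∀ i, d i = 0 → u i = 0) : tangentVector k s v u =
      ∑ q ∈ nontrivialSlots s d, PiTensorProduct.tprod k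
        (Function.update (fun q : (Σ i : Fin n, Fin (s i)) => v q.1) q (u q.1)) := by
  rw [tangentVector_eq_sum]
  refine (Finset.sum_subset (Finset.subset_univ _) fun q _ hq => ?_).symm
  rw [mem_nontrivialSlots, Nat.pos_iff_ne_zero, not_not] at hq
  rw [hu _ hq, MultilinearMap.map_update_zero]

/-- If at most two slots are nontrivial, secant vectors with the same components in the trivial
factors are tangent. -/
theorem add_mem_tangentCone [IsAlgClosed k] [CharZero k] (hs : ∀ i, 0 < s i)
    (hQ : (nontrivialSlots s d).card ≤ 2) {v w : ∀ i, V i} (hv : ∀ i, v i ≠ 0)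
    (hw : ∀ i, w i ≠ 0) (hvw : ∀ i, d i = 0 → w i = v i) (a c : k) :
    a • conePoint k V s v + c • conePoint k V s w ∈ tangentCone k V s := by
  have hoff : ∀ q : (Σ i : Fin n, Fin (s i)), q ∉ nontrivialSlots s d → d q.1 = 0 := by
    intro q hq
    rwa [mem_nontrivialSlots, Nat.pos_iff_ne_zero, not_not] at hq
  interval_cases hcard : (nontrivialSlots s d).card
  · refine ⟨a + c, v, 0, hv, ?_⟩
    have : w = v := funext fun i => hvw i (hoff ⟨i, ⟨0, hs i⟩⟩ (by
      rw [Finset.card_eq_zero.1 hcard]; simp))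
    rw [this, tangentVector_zero, add_zero, add_smul]
  · obtain ⟨q₁, hq₁⟩ := Finset.card_eq_one.1 hcard
    -- Only one slot varies and the tensor is linear in it, so the second point is itself a tangent
    -- direction.
    refine ⟨a, v, fun i => if d i = 0 then 0 else c • w i, hv, ?_⟩
    rw [tangentVector_eq_sum_nontrivialSlots (d := d) v fun i hi => if_pos hi, hq₁,
      Finset.sum_singleton, if_neg, MultilinearMap.map_update_smul]
    · congr 2
      refine congrArg (PiTensorProduct.tprod k) (funext fun q => ?_)
      by_cases hq : q = q₁
      · subst hq; rw [Function.update_self]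
      · rw [Function.update_of_ne hq]
        exact hvw _ (hoff q (by simpa [hq₁] using hq))
    · exact (mem_nontrivialSlots.1 (hq₁ ▸ Finset.mem_singleton_self q₁)).ne'
  · obtain ⟨q₁, q₂, hne, hq⟩ := Finset.card_eq_two.1 hcard
    have hmem : ∀ q, q ≠ q₁ → q ≠ q₂ → d q.1 = 0 := fun q h₁ h₂ => hoff q (by simp [hq, h₁, h₂])
    have hd₁ : d q₁.1 ≠ 0 :=
      (mem_nontrivialSlots.1 (show q₁ ∈ nontrivialSlots s d by simp [hq])).ne'
    have hd₂ : d q₂.1 ≠ 0 :=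
      (mem_nontrivialSlots.1 (show q₂ ∈ nontrivialSlots s d by simp [hq])).ne'
    by_cases hi : q₁.1 = q₂.1
    -- Both slots lie in one factor. With α² = a and β² = -c, the quadratic form av² + cw² equals
    -- (αv + βw)(αv - βw) = 2pr, the derivative of the square at p in direction r.
    · obtain ⟨α, hα⟩ := IsAlgClosed.exists_pow_nat_eq a (n := 2) (by norm_num)
      obtain ⟨β, hβ⟩ := IsAlgClosed.exists_pow_nat_eq (-c) (n := 2) (by norm_num)
      let x : ∀ q : (Σ i : Fin n, Fin (s i)), V q.1 := fun q => v q.1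
      let p : ∀ i, V i := fun i => α • v i + β • w i
      let r : ∀ i, V i := fun i => (α / 2) • v i + (-(β / 2)) • w i
      let M : V q₁.1 → V q₂.1 → Ambient k V s := fun y z =>
        PiTensorProduct.tprod k (Function.update (Function.update x q₁ y) q₂ z)
      have hM₁ : ∀ (e e' : k) y y' z, M (e • y + e' • y') z = e • M y z + e' • M y' z := by
        intro e e' y y' z
        simp only [M]
        simp only [Function.update_comm hne, MultilinearMap.map_update_add,
          MultilinearMap.map_update_smul]
      have hM₂ : ∀ (e e' : k) y z z', M y (e • z + e' • z') = e • M y z + e' • M y z' := by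
        intro e e' y z z'
        simp only [M, MultilinearMap.map_update_add, MultilinearMap.map_update_smul]
      have hMv : M (v q₁.1) (v q₂.1) = conePoint k V s v := by
        simp only [M]
        rw [show v q₁.1 = x q₁ from rfl, show v q₂.1 = x q₂ from rfl, Function.update_eq_self,
          Function.update_eq_self]
        rfl
      have hMw : M (w q₁.1) (w q₂.1) = conePoint k V s w := by
        simp only [M, conePoint]
        congr 1
        funext q
        by_cases h₂ : q = q₂
        · subst h₂; rw [Function.update_self]
        · rw [Function.update_of_ne h₂]
          by_cases h₁ : q = q₁
          · subst h₁; rw [Function.update_self]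
          · rw [Function.update_of_ne h₁]
            exact (hvw _ (hmem q h₁ h₂)).symm
      have hsum : a • conePoint k V s v + c • conePoint k V s w =
          M (r q₁.1) (p q₂.1) + M (p q₁.1) (r q₂.1) := by
        simp only [r, p, hM₁, hM₂, hMv, hMw]
        rw [← hα, show c = -β ^ 2 by rw [hβ, neg_neg]]
        module
      rw [hsum]
      -- A zero `p` is not an admissible base point, but then the whole sum vanishes.
      by_cases hp : p q₁.1 = 0
      · refine ⟨0, v, 0, hv, ?_⟩
        have hp₂ : p q₂.1 = 0 := hi ▸ hp
        have h₁ := hM₁ 0 0 0 0 (r q₂.1)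
        have h₂ := hM₂ 0 0 (r q₁.1) 0 0
        simp only [zero_smul, add_zero] at h₁ h₂
        rw [hp, hp₂, h₁, h₂, tangentVector_zero, zero_smul]
      · refine ⟨0, fun i => if d i = 0 then v i else p i, fun i => if d i = 0 then 0 else r i,
          fun i => ?_, ?_⟩
        · beta_reduce
          split_ifs with h
          · exact hv i
          · by_cases h₁ : (⟨i, ⟨0, hs i⟩⟩ : Σ i : Fin n, Fin (s i)) = q₁
            · have : i = q₁.1 := by rw [← h₁]
              exact this ▸ hp
            · by_cases h₂ : (⟨i, ⟨0, hs i⟩⟩ : Σ i : Fin n, Fin (s i)) = q₂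
              · have : i = q₁.1 := by rw [hi, ← h₂]
                exact this ▸ hp
              · exact absurd (hmem _ h₁ h₂) h
        · rw [tangentVector_eq_sum_nontrivialSlots (d := d) _ fun i hi => if_pos hi, hq,
            Finset.sum_pair hne, zero_smul, zero_add, if_neg hd₁, if_neg hd₂]
          have hbase : (fun q : (Σ i : Fin n, Fin (s i)) => if d q.1 = 0 then v q.1 else p q.1) =
              Function.update (Function.update x q₁ (p q₁.1)) q₂ (p q₂.1) := by
            funext q
            by_cases h₂ : q = q₂
            · subst h₂; rw [Function.update_self, if_neg hd₂]
            · rw [Function.update_of_ne h₂]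
              by_cases h₁ : q = q₁
              · subst h₁; rw [Function.update_self, if_neg hd₁]
              · rw [Function.update_of_ne h₁, if_pos (hmem q h₁ h₂)]
          rw [hbase, Function.update_idem, Function.update_comm hne, Function.update_idem,
            Function.update_comm hne.symm]
    -- The slots lie in different factors: a v₁⊗v₂ + c w₁⊗w₂ is tangent at v₁⊗w₂ in the direction (c
    -- w₁, a v₂).
    · refine ⟨0, fun i => if i = q₁.1 then v i else w i,
        fun i => if d i = 0 then 0 else if i = q₁.1 then c • w i else a • v i, fun i => ?_, ?_⟩
      · beta_reduce
        split_ifs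
        exacts [hv i, hw i]
      · rw [tangentVector_eq_sum_nontrivialSlots (d := d) _ fun i hi => if_pos hi, hq,
          Finset.sum_pair hne, zero_smul, zero_add, if_neg hd₁, if_neg hd₂, if_pos rfl,
          if_neg (Ne.symm hi), MultilinearMap.map_update_smul, MultilinearMap.map_update_smul,
          add_comm]
        congr 2
        · refine congrArg (PiTensorProduct.tprod k) (funext fun q => ?_)
          by_cases h₁ : q = q₁
          · subst h₁; rw [Function.update_self]
          · rw [Function.update_of_ne h₁]
            split_ifs with h
            · refine hvw _ (hmem q h₁ fun h₂ => hi ?_)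
              rw [← h, h₂]
            · rfl
        · refine congrArg (PiTensorProduct.tprod k) (funext fun q => ?_)
          by_cases h₂ : q = q₂
          · subst h₂; rw [Function.update_self]
          · rw [Function.update_of_ne h₂]
            split_ifs with h
            · rfl
            · exact (hvw _ (hmem q (fun h₁ => h (by rw [h₁])) h₂)).symm

theorem tangentialVariety_eq_secantVariety [IsAlgClosed k] [CharZero k]
    [∀ i, Module.Finite k (V i)] (b : ∀ i, Module.Basis (Fin (d i + 1)) k (V i))
    (hs : ∀ i, 0 < s i) (hQ : (nontrivialSlots s d).card ≤ 2) :
    tangentialVariety (variety k V s) = secantVariety (variety k V s) := by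
  refine (tangentialVariety_subset_secantVariety hs
    fun i => ⟨b i 0, (b i).ne_zero 0⟩).antisymm ?_
  rw [tangentialVariety_eq hs, secantVariety_eq hs]
  refine closure_mono ?_
  rintro _ ⟨_, ⟨a, c, v, w, rfl⟩, hne, rfl⟩
  refine ⟨_, ?_, hne, rfl⟩
  have hsingle : ∀ (a : k) (v : ∀ i, V i), a • conePoint k V s v ∈ tangentCone k V s := by
    intro a v
    by_cases hv : ∀ i, v i ≠ 0
    · exact ⟨a, v, 0, hv, by rw [tangentVector_zero, add_zero]⟩
    · push Not at hv
      obtain ⟨i, hi⟩ := hv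
      exact ⟨0, fun i => b i 0, 0, fun i => (b i).ne_zero 0, by
        rw [conePoint_eq_zero hs hi, smul_zero, zero_smul, tangentVector_zero, add_zero]⟩
  by_cases hv : ∀ i, v i ≠ 0
  · by_cases hw : ∀ i, w i ≠ 0
    · have hline : ∀ i, d i = 0 → ∀ y : V i, y = (b i).repr y 0 • b i 0 := by
        refine fun i hi y => (b i).ext_elem fun j => ?_
        obtain rfl : j = 0 := Fin.ext (by simp; omega)
        simp
      -- In a one-dimensional factor `w i` is a multiple of `v i`. These scalars are absorbed into
      -- the coefficient `c`, so that both points agree in the trivial factors.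
      let g : Fin n → k := fun i => if d i = 0 then (b i).repr (w i) 0 / (b i).repr (v i) 0 else 1
      let w' : ∀ i, V i := fun i => if d i = 0 then v i else w i
      have hw' : w = fun i => g i • w' i := by
        funext i
        by_cases hi : d i = 0
        · simp only [g, w', if_pos hi]
          have h0 : (b i).repr (v i) 0 ≠ 0 := fun h0 => hv i (by
            rw [hline i hi (v i), h0, zero_smul])
          conv_lhs => rw [hline i hi (w i)]
          conv_rhs => rw [hline i hi (v i)]
          simp [smul_smul, h0]
        · simp only [g, w', if_neg hi, one_smul]
      rw [hw', conePoint_smul, smul_smul]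
      refine add_mem_tangentCone hs hQ hv (fun i => ?_) (fun i hi => if_pos hi) _ _
      split_ifs
      exacts [hv i, hw i]
    · push Not at hw
      obtain ⟨i, hi⟩ := hw
      rw [conePoint_eq_zero hs hi, smul_zero, add_zero]
      exact hsingle a v
  · push Not at hv
    obtain ⟨i, hi⟩ := hv
    rw [conePoint_eq_zero hs hi, smul_zero, zero_add]
    exact hsingle c w

end Degenerate

/-! ### The polytope -/

theorem card_nontrivialSlots {n : ℕ} (s d : Fin n → ℕ) :
    (nontrivialSlots s d).card = ∑ i, if 0 < d i then s i else 0 := by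
  rw [nontrivialSlots, Finset.card_filter, Fintype.sum_sigma]
  refine Finset.sum_congr rfl fun i _ => ?_
  split_ifs <;> simp

/-- Factors with `d i = 0` carry no coordinates, so the constraints bound the coordinate sum by the
number of nontrivial slots. Putting the full weight `s i` on the first coordinate of each other
factor attains this bound. -/
theorem not_polytope_subset_hyperplaneTwo_iff {n : ℕ} (s d : Fin n → ℕ) :
    ¬ polytope d s ⊆ hyperplaneTwo d ↔ 3 ≤ (nontrivialSlots s d).card := by
  constructor
  · intro h
    by_contra! hlt
    refine h fun x hx => le_antisymm ?_ hx.2.2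
    have h1 : ∑ q, x q ≤ ((nontrivialSlots s d).card : ℚ) := by
      rw [card_nontrivialSlots, Fintype.sum_sigma, Nat.cast_sum]
      refine Finset.sum_le_sum fun i _ => ?_
      split_ifs with hi
      · exact hx.2.1 i
      · have : IsEmpty (Fin (d i)) := by
          rw [Nat.pos_iff_ne_zero, not_not] at hi
          rw [hi]
          infer_instance
        simp
    refine h1.trans ?_
    exact_mod_cast Nat.lt_succ_iff.1 hlt
  · intro h hsub
    let x : (Σ i : Fin n, Fin (d i)) → ℚ := fun q => if q.2.val = 0 then s q.1 else 0
    have hx : ∀ i, ∑ j : Fin (d i), x ⟨i, j⟩ = if 0 < d i then (s i : ℚ) else 0 := by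
      intro i
      split_ifs with hi
      · rw [Finset.sum_eq_single ⟨0, hi⟩]
        · simp [x]
        · intro j _ hj
          exact if_neg fun h => hj (Fin.ext h)
        · simp
      · refine Finset.sum_eq_zero fun j _ => absurd (Nat.zero_lt_of_lt j.2) hi
    have hsum : ∑ q, x q = ((nontrivialSlots s d).card : ℚ) := by
      rw [card_nontrivialSlots, Fintype.sum_sigma, Nat.cast_sum]
      refine Finset.sum_congr rfl fun i _ => ?_
      rw [hx]
      split_ifs <;> simp
    have h3 : (3 : ℚ) ≤ ∑ q, x q := by
      rw [hsum]
      exact_mod_cast h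
    have hmem : x ∈ hyperplaneTwo d := hsub ⟨fun q => by
      simp only [x]; split_ifs <;> simp, fun i => by
        rw [hx]; split_ifs <;> simp, by linarith⟩
    have : ∑ q, x q = 2 := hmem
    linarith

/-- Finiteness of the dimension is what excludes `dim + 1 = dim` when the two varieties coincide. -/
theorem exists_natCast_eq {x : WithBot ℕ∞} {a c : ℕ} (h₁ : (a : WithBot ℕ∞) ≤ x)
    (h₂ : x ≤ (c : WithBot ℕ∞)) : ∃ N : ℕ, x = N := by
  induction x using WithBot.recBotCoe with
  | bot => exact absurd h₁ (by simp)
  | coe x =>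
    have h₃ : x ≤ (c : ℕ∞) := by exact_mod_cast h₂
    lift x to ℕ using ne_top_of_le_ne_top (ENat.natCast_ne_top c) h₃
    exact ⟨x, rfl⟩

end SegreVeronese

theorem mainTheorem9 {k : Type*} [Field k] [IsAlgClosed k] [CharZero k] {n : ℕ}
    (V : Fin n → Type*) [∀ i, AddCommGroup (V i)] [∀ i, Module k (V i)]
    (d s : Fin n → ℕ) (hd : ∀ i, Module.finrank k (V i) = d i + 1) (hs : ∀ i, 0 < s i)
    (X : Set (ℙ k (SegreVeronese.Ambient k V s))) (hX : X = SegreVeronese.variety k V s) :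
    List.TFAE
      [¬ SegreVeronese.polytope d s ⊆ SegreVeronese.hyperplaneTwo d,
       SegreVeronese.dim (SegreVeronese.secantVariety X) = 2 * SegreVeronese.dim X + 1,
       SegreVeronese.secantVariety X ≠ SegreVeronese.tangentialVariety X,
       SegreVeronese.dim (SegreVeronese.tangentialVariety X) + 1 =
         SegreVeronese.dim (SegreVeronese.secantVariety X)] ∧
    ((SegreVeronese.dim (SegreVeronese.tangentialVariety X) = 2 * SegreVeronese.dim X ∧
        SegreVeronese.dim (SegreVeronese.secantVariety X) = 2 * SegreVeronese.dim X + 1) ∨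
      SegreVeronese.tangentialVariety X = SegreVeronese.secantVariety X) := by
  subst hX
  have hfin : ∀ i, Module.Finite k (V i) := fun i =>
    Module.finite_of_finrank_pos (by rw [hd]; exact Nat.succ_pos _)
  let b : ∀ i, Module.Basis (Fin (d i + 1)) k (V i) := fun i =>
    Module.finBasisOfFinrankEq k (V i) (hd i)
  rw [SegreVeronese.not_polytope_subset_hyperplaneTwo_iff]
  have hdimX : SegreVeronese.dim (SegreVeronese.variety k V s) = (∑ i, d i : ℕ) :=
    (SegreVeronese.topologicalKrullDim_variety_le b hs).antisymm
      (SegreVeronese.card_le_topologicalKrullDim_variety b hs)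
  have hXT := SegreVeronese.variety_subset_tangentialVariety (k := k) (V := V) hs
  by_cases hQ : 3 ≤ (SegreVeronese.nontrivialSlots s d).card
  · have hne := SegreVeronese.secantVariety_ne_tangentialVariety b hs hQ
    have hT : SegreVeronese.dim (SegreVeronese.tangentialVariety (SegreVeronese.variety k V s)) =
        (2 * ∑ i, d i : ℕ) :=
      (SegreVeronese.topologicalKrullDim_tangentialVariety_le b hs).antisymm
        (SegreVeronese.two_mul_le_topologicalKrullDim_tangentialVariety b hs hQ)
    have hTne : (SegreVeronese.tangentialVariety (SegreVeronese.variety k V s)).Nonempty :=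
      Set.Nonempty.mono hXT ⟨_, fun i => b i 0, fun i => (b i).ne_zero 0,
        Projectivization.submodule_mk _ (SegreVeronese.conePoint_ne_zero
          fun i => (b i).ne_zero 0)⟩
    have hS : SegreVeronese.dim (SegreVeronese.secantVariety (SegreVeronese.variety k V s)) =
        (2 * (∑ i, d i) + 1 : ℕ) := by
      refine (SegreVeronese.topologicalKrullDim_secantVariety_le b hs).antisymm ?_
      -- No separate lower bound for secants is needed: the tangential variety is proper and closed
      -- in the irreducible secant variety, which supplies the missing one.
      refine le_trans ?_ (SegreVeronese.topologicalKrullDim_add_one_le isClosed_closure hTne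
        (SegreVeronese.isIrreducible_secantVariety b hs)
        (SegreVeronese.tangentialVariety_subset_secantVariety hs
          fun i => ⟨b i 0, (b i).ne_zero 0⟩) hne.symm)
      change _ ≤ SegreVeronese.dim (SegreVeronese.tangentialVariety _) + 1
      rw [hT]
      push_cast
      exact le_rfl
    have h2 : SegreVeronese.dim (SegreVeronese.secantVariety (SegreVeronese.variety k V s)) =
        2 * SegreVeronese.dim (SegreVeronese.variety k V s) + 1 := by
      rw [hS, hdimX]
      push_cast
      rfl
    have h3 : SegreVeronese.dim (SegreVeronese.tangentialVariety (SegreVeronese.variety k V s)) =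
        2 * SegreVeronese.dim (SegreVeronese.variety k V s) := by
      rw [hT, hdimX]
      push_cast
      rfl
    have h4 :
        SegreVeronese.dim (SegreVeronese.tangentialVariety (SegreVeronese.variety k V s)) + 1 =
        SegreVeronese.dim (SegreVeronese.secantVariety (SegreVeronese.variety k V s)) := by
      rw [h2, h3]
    exact ⟨by simp [hQ, hne, h2, h4], .inl ⟨h3, h2⟩⟩
  -- Once the varieties coincide, the tangential bound of twice `dim X` contradicts (ii), and
  -- finiteness contradicts (iv).
  · have heq := SegreVeronese.tangentialVariety_eq_secantVariety b hs (by omega)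
    have hle : SegreVeronese.dim (SegreVeronese.secantVariety (SegreVeronese.variety k V s)) ≤
        (2 * ∑ i, d i : ℕ) := by
      rw [← heq]
      exact SegreVeronese.topologicalKrullDim_tangentialVariety_le b hs
    have hge : ((∑ i, d i : ℕ) : WithBot ℕ∞) ≤
        SegreVeronese.dim (SegreVeronese.secantVariety (SegreVeronese.variety k V s)) := by
      rw [← hdimX, ← heq]
      exact SegreVeronese.topologicalKrullDim_mono hXT
    obtain ⟨N, hN⟩ : ∃ N : ℕ,
        SegreVeronese.dim (SegreVeronese.secantVariety (SegreVeronese.variety k V s)) = N :=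
      SegreVeronese.exists_natCast_eq hge hle
    have h2 : SegreVeronese.dim (SegreVeronese.secantVariety (SegreVeronese.variety k V s)) ≠
        2 * SegreVeronese.dim (SegreVeronese.variety k V s) + 1 := by
      intro h
      rw [h, hdimX] at hle
      have : 2 * (∑ i, d i) + 1 ≤ 2 * ∑ i, d i := by exact_mod_cast hle
      omega
    have h4 :
        SegreVeronese.dim (SegreVeronese.tangentialVariety (SegreVeronese.variety k V s)) + 1 ≠
        SegreVeronese.dim (SegreVeronese.secantVariety (SegreVeronese.variety k V s)) := by
      rw [heq, hN]
      intro h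
      have : N + 1 = N := by exact_mod_cast h
      omega
    exact ⟨by simp [hQ, heq, h2, heq ▸ h4], .inr heq⟩
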